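/- **Setting.** Let $k$ be a field and let $(\mathcal S,\mathcal M,\Gamma)$ be a marked ribbon surface: an oriented connected surface with non-empty boundary, a finite set $\mathcal M\subset\partial\mathcal S$ of marked points, and a system $\Gamma$ of arcs with endpoints in $\mathcal M$ and pairwise disjoint interiors, which cuts $\mathcal S$ into finitely many elementary polygons, each having at least one side in $\Gamma$ and exactly one side not in $\Gamma$; that side is either a boundary segment between two marked points (the polygon is then a disc) or a boundary component of $\mathcal S$ without marked points (the polygon is then an annulus). An arc $\gamma:(0,1)\to\mathcal S\setminus\partial\mathcal S$ and its reverse $\gamma^-(x)=\gamma(1-x)$ are the same element of $\Gamma$; $\gamma(0^+)$ and $\gamma(1^-)$ denote the endpoints of the oriented arc $\gamma$. Let $A=kQ/I$ be the gentle algebra of the surface: the vertices of $Q$ are the arcs; every corner of an elementary polygon between two sides $u,v\in\Gamma$ such that $v$ follows $u$ in the counterclockwise order around the marked point at that corner gives an arrow $u\to v$; and $I$ is generated by the paths $u\to v\to w$ given by two consecutive corners of the same elementary polygon. Paths are composed from left to right and modules are right modules. For an arc $\gamma$ let $P(\gamma)=e_\gamma A$ be the indecomposable projective module and $S(\gamma)=M(c^{\gamma}_{\mathrm{simp}})$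 the simple module at the vertex $\gamma$ (one-dimensional, with $e_\gamma$ acting as the identity and all arrows as zero). **Conditions.** A finite sequence $\gamma^0,\dots,\gamma^n$ ($n\ge 0$) of oriented arcs satisfies (PD), respectively (ID), if 1. $\gamma^0,\dots,\gamma^n$ are sides of one elementary polygon; 2. $\gamma^{i-1}(1^-)=\gamma^{i}(0^+)$ for $1\le i\le n$; 3. for $1\le i\le n$, at the corner of that polygon formed by the end of $\gamma^{i-1}$ and the start of $\gamma^i$, the arc $\gamma^i$ follows $\gamma^{i-1}$ in the counterclockwise (respectively, clockwise) order around the marked point; 4. there is no oriented arc $\gamma$ such that $\gamma^0,\dots,\gamma^n,\gamma$ satisfies 1–3. Arcs may occur repeatedly in such a sequence. **Statement.** Let $\gamma^0$ be an oriented arc with endpoints $p=\gamma^0(0^+)$ and $q=\gamma^0(1^-)$. (a) Suppose that $\gamma^0,\gamma^1,\dots,\gamma^n$ satisfies (PD) (a chain leaving $\gamma^0$ at $q$), and that $\gamma'^0,\gamma'^1,\dots,\gamma'^m$ satisfies (PD), where $\gamma'^0=(\gamma^0)^-$ (a chain leaving $\gamma^0$ at $p$). Then $$\mathrm{proj.dim}\,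 S(\gamma^0)=\max\{n,m\},$$ and $S(\gamma^0)$ has a minimal projective resolution of the form $$\cdots\to P(\gamma^2)\oplus P(\gamma'^2)\to P(\gamma^1)\oplus P(\gamma'^1)\to P(\gamma^0)\to S(\gamma^0)\to 0,$$ where $P(\gamma^i)=0$ for $i>n$ and $P(\gamma'^i)=0$ for $i>m$. (b) Suppose that $\gamma^0,\gamma^1,\dots,\gamma^n$ and $\gamma'^0,\gamma'^1,\dots,\gamma'^m$, with $\gamma'^0=(\gamma^0)^-$, both satisfy (ID). Then $$\mathrm{inj.dim}\, S(\gamma^0)=\max\{n,m\}.$$ -/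

import Mathlib

universe u

noncomputable section

/-! ### The path algebra of a finite quiver

Paths are composed from left to right: `p * q` is the path "first `p`, then `q`" if `p` ends where
`q` starts, and `0` otherwise. -/

section PathAlgebra

variable (k : Type u) [Field k] (V : Type) [Quiver.{0} V]

/-- The path algebra `kQ`: the vector space with basis all paths of the quiver `Q` on `V`. -/
def PathAlgebra : Type u := (Σ a b : V, Quiver.Path a b) →₀ k

namespace PathAlgebra

instance : AddCommGroup (PathAlgebra k V) :=
  inferInstanceAs (AddCommGroup ((Σ a b : V, Quiver.Path a b) →₀ k))

instance : Module k (PathAlgebra k V) :=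
  inferInstanceAs (Module k ((Σ a b : V, Quiver.Path a b) →₀ k))

variable {V}

/-- A path, as an element of the path algebra. -/
def ofPath {a b : V} (p : Quiver.Path a b) : PathAlgebra k V :=
  Finsupp.single ⟨a, b, p⟩ 1

open Classical in
/-- The product of two basis elements. -/
def pathMul (p q : Σ a b : V, Quiver.Path a b) : PathAlgebra k V :=
  if h : q.1 = p.2.1 then ofPath k (p.2.2.comp (q.2.2.cast h rfl)) else 0

/-- The multiplication, as a bilinear map. -/
def mulHom : PathAlgebra k V →ₗ[k] PathAlgebra k V →ₗ[k] PathAlgebra k V :=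
  Finsupp.linearCombination k fun p => Finsupp.linearCombination k fun q => pathMul k p q

instance : Mul (PathAlgebra k V) := ⟨fun x y => mulHom k x y⟩

instance [Fintype V] : One (PathAlgebra k V) := ⟨∑ v : V, ofPath k (Quiver.Path.nil : Quiver.Path v v)⟩

variable {k}

theorem mul_def (x y : PathAlgebra k V) : x * y = mulHom k x y := rfl

theorem one_def [Fintype V] :
    (1 : PathAlgebra k V) = ∑ v : V, ofPath k (Quiver.Path.nil : Quiver.Path v v) := rfl

theorem mulHom_ofPath {a b c d : V} (p : Quiver.Path a b) (q : Quiver.Path c d) :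
    mulHom k (ofPath k p) (ofPath k q) = pathMul k ⟨a, b, p⟩ ⟨c, d, q⟩ := by
  have h1 : mulHom k (ofPath k p) =
      Finsupp.linearCombination k fun q => pathMul k ⟨a, b, p⟩ q := by
    exact (Finsupp.linearCombination_single k (1 : k) _).trans (one_smul _ _)
  rw [h1]
  exact (Finsupp.linearCombination_single k (1 : k) _).trans (one_smul _ _)

theorem ofPath_mul_ofPath {a b c : V} (p : Quiver.Path a b) (q : Quiver.Path b c) :
    ofPath k p * ofPath k q = ofPath k (p.comp q) := by
  rw [mul_def, mulHom_ofPath]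
  simp [pathMul]

theorem ofPath_mul_ofPath_of_ne {a b c d : V} (p : Quiver.Path a b) (q : Quiver.Path c d)
    (h : c ≠ b) : ofPath k p * ofPath k q = 0 := by
  rw [mul_def, mulHom_ofPath]
  simp [pathMul, h]

/-- The paths span the path algebra: induction principle. -/
theorem induction {motive : PathAlgebra k V → Prop} (x : PathAlgebra k V) (zero : motive 0)
    (add : ∀ x y, motive x → motive y → motive (x + y))
    (smul : ∀ (c : k) {a b : V} (p : Quiver.Path a b), motive (c • ofPath k p)) : motive x := by
  refine Finsupp.induction_linear (motive := motive) x zero add ?_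
  rintro ⟨a, b, p⟩ c
  have : (Finsupp.single ⟨a, b, p⟩ c : (Σ a b : V, Quiver.Path a b) →₀ k) = c • ofPath k p := by
    simp [ofPath]
    exact (Finsupp.smul_single_one _ c).symm
  rw [this]
  exact smul c p

theorem add_mul' (x y z : PathAlgebra k V) : (x + y) * z = x * z + y * z := by
  simp [mul_def]

theorem mul_add' (x y z : PathAlgebra k V) : x * (y + z) = x * y + x * z := by
  simp [mul_def]

theorem smul_mul' (c : k) (x y : PathAlgebra k V) : (c • x) * y = c • (x * y) := by
  simp [mul_def]

theorem mul_smul' (c : k) (x y : PathAlgebra k V) : x * (c • y) = c • (x * y) := by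
  simp [mul_def]

theorem zero_mul' (x : PathAlgebra k V) : 0 * x = 0 := by simp [mul_def]

theorem mul_zero' (x : PathAlgebra k V) : x * 0 = 0 := by simp [mul_def]

theorem mul_assoc' (x y z : PathAlgebra k V) : x * y * z = x * (y * z) := by
  induction x using induction with
  | zero => simp [zero_mul']
  | add x x' h h' => simp [add_mul', h, h']
  | smul r p =>
    rename_i a b
    induction y using induction with
    | zero => simp [zero_mul', mul_zero']
    | add y y' h h' => simp [add_mul', mul_add', h, h']
    | smul s q =>
      rename_i c d
      induction z using induction with
      | zero => simp [mul_zero']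
      | add z z' h h' => simp [mul_add', h, h']
      | smul t w =>
        rename_i e f
        simp only [smul_mul', mul_smul']
        congr 3
        by_cases h1 : c = b
        · subst h1
          rw [ofPath_mul_ofPath]
          by_cases h2 : e = d
          · subst h2
            simp [ofPath_mul_ofPath, Quiver.Path.comp_assoc]
          · simp [ofPath_mul_ofPath_of_ne _ _ h2, mul_zero']
        · rw [ofPath_mul_ofPath_of_ne _ _ h1, zero_mul']
          by_cases h2 : e = d
          · subst h2
            rw [ofPath_mul_ofPath, ofPath_mul_ofPath_of_ne _ _ h1]
          · simp [ofPath_mul_ofPath_of_ne _ _ h2, mul_zero']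

theorem sum_mul' [Fintype V] (f : V → PathAlgebra k V) (y : PathAlgebra k V) :
    (∑ v, f v) * y = ∑ v, f v * y := by
  simp [mul_def]

theorem mul_sum' [Fintype V] (f : V → PathAlgebra k V) (y : PathAlgebra k V) :
    y * (∑ v, f v) = ∑ v, y * f v := by
  simp [mul_def]

theorem one_mul' [Fintype V] (x : PathAlgebra k V) : 1 * x = x := by
  induction x using induction with
  | zero => exact mul_zero' _
  | add x y h h' => rw [mul_add', h, h']
  | smul c p =>
    rename_i a b
    rw [mul_smul', one_def, sum_mul', Finset.sum_eq_single a]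
    · rw [ofPath_mul_ofPath, Quiver.Path.nil_comp]
    · intro v _ hv
      exact ofPath_mul_ofPath_of_ne _ _ hv.symm
    · simp

theorem mul_one' [Fintype V] (x : PathAlgebra k V) : x * 1 = x := by
  induction x using induction with
  | zero => exact zero_mul' _
  | add x y h h' => rw [add_mul', h, h']
  | smul c p =>
    rename_i a b
    rw [smul_mul', one_def, mul_sum', Finset.sum_eq_single b]
    · rw [ofPath_mul_ofPath, Quiver.Path.comp_nil]
    · intro v _ hv
      exact ofPath_mul_ofPath_of_ne _ _ hv
    · simp

instance [Fintype V] : Ring (PathAlgebra k V) :=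
  { (inferInstance : AddCommGroup (PathAlgebra k V)) with
    mul_assoc := mul_assoc'
    one_mul := one_mul'
    mul_one := mul_one'
    zero_mul := zero_mul'
    mul_zero := mul_zero'
    left_distrib := mul_add'
    right_distrib := add_mul' }

instance [Fintype V] : Algebra k (PathAlgebra k V) := Algebra.ofModule smul_mul' mul_smul'

/-- The coefficient of the trivial path at a vertex `v`: a character of the path algebra. -/
def coeffNil [Fintype V] (v : V) : PathAlgebra k V →ₗ[k] k :=
  Finsupp.lapply ⟨v, v, Quiver.Path.nil⟩

theorem coeffNil_nil_self [Fintype V] (v : V) :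
    coeffNil v (ofPath k (Quiver.Path.nil : Quiver.Path v v)) = 1 :=
  Finsupp.single_eq_same

theorem coeffNil_nil_of_ne [Fintype V] {v w : V} (h : w ≠ v) :
    coeffNil v (ofPath k (Quiver.Path.nil : Quiver.Path w w)) = 0 :=
  Finsupp.single_eq_of_ne (by rintro h'; cases h'; exact h rfl)

theorem coeffNil_ofPath_of_length_pos [Fintype V] (v : V) {a b : V} (p : Quiver.Path a b)
    (h : 0 < p.length) : coeffNil v (ofPath k p) = 0 :=
  Finsupp.single_eq_of_ne (by rintro h'; cases h'; simp at h)

theorem coeffNil_mul [Fintype V] (v : V) (x y : PathAlgebra k V) :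
    coeffNil v (x * y) = coeffNil v x * coeffNil v y := by
  induction x using induction with
  | zero => rw [zero_mul']; simp
  | add x x' h h' => rw [add_mul', map_add, h, h', map_add, add_mul]
  | smul c p =>
    rename_i a b
    induction y using induction with
    | zero => rw [mul_zero']; simp
    | add y y' h h' => rw [mul_add', map_add, h, h', map_add, mul_add]
    | smul s q =>
      rename_i c' d
      simp only [smul_mul', mul_smul', map_smul, smul_eq_mul]
      suffices h : coeffNil v (ofPath k p * ofPath k q) =
          coeffNil v (ofPath k p) * coeffNil v (ofPath k q) by rw [h]; ring
      by_cases hbc : c' = b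
      · subst hbc
        rw [ofPath_mul_ofPath]
        rcases Nat.eq_zero_or_pos p.length with hp | hp
        · obtain rfl := Quiver.Path.eq_of_length_zero p hp
          obtain rfl := Quiver.Path.eq_nil_of_length_zero p hp
          rw [Quiver.Path.nil_comp]
          by_cases hv : a = v
          · subst hv
            rw [coeffNil_nil_self, one_mul]
          · rw [coeffNil_nil_of_ne hv, zero_mul]
            exact Finsupp.single_eq_of_ne (by rintro h'; cases h'; exact hv rfl)
        · rw [coeffNil_ofPath_of_length_pos v p hp, zero_mul, coeffNil_ofPath_of_length_pos]
          rw [Quiver.Path.length_comp]; omega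
      · rw [ofPath_mul_ofPath_of_ne _ _ hbc, map_zero]
        by_cases hv : b = v
        · have : coeffNil v (ofPath k q) = 0 :=
            Finsupp.single_eq_of_ne (by rintro h'; cases h'; exact hbc hv.symm)
          rw [this, mul_zero]
        · have : coeffNil v (ofPath k p) = 0 :=
            Finsupp.single_eq_of_ne (by rintro h'; cases h'; exact hv rfl)
          rw [this, zero_mul]

theorem coeffNil_one [Fintype V] (v : V) : coeffNil v (1 : PathAlgebra k V) = 1 := by
  rw [one_def, map_sum, Finset.sum_eq_single v]
  · exact coeffNil_nil_self v
  · intro w _ hw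
    exact coeffNil_nil_of_ne hw
  · simp

/-- The ring homomorphism `kQ → k` that sends the trivial path at `v` to `1` and every other path
to `0`. -/
def character [Fintype V] (v : V) : PathAlgebra k V →+* k where
  toFun := coeffNil v
  map_one' := coeffNil_one v
  map_mul' := coeffNil_mul v
  map_zero' := map_zero _
  map_add' := map_add _

end PathAlgebra

end PathAlgebra

/-! ### Marked ribbon surfaces

A marked ribbon surface `(𝒮, ℳ, Γ)` is cut by its arc system `Γ` into elementary polygons
`Δ_1, …, Δ_d`, each with exactly one side that is not an arc; hence it is the surface obtained from
these polygons by gluing them back along the arcs. This is the form in which it is described here.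

* An elementary polygon is either a disc whose boundary circle is divided into `n + 1` sides, the
  first `n ≥ 1` of which (in the clockwise order) are arcs and the last of which is a boundary
  segment of `𝒮`; or an annulus whose outer boundary circle is divided into `n ≥ 1` sides, all of
  them arcs, and whose inner boundary circle is an unmarked boundary component of `𝒮`.
* The arc sides are glued in pairs; both sides of a pair are traversed clockwise around their own
  polygon, and the gluing reverses the direction, so that `𝒮` is oriented.
-/

/-- The gluing data of an oriented surface dissected into elementary polygons. -/
structure PolygonGluing where
  /-- the number of elementary polygons -/
  numPolygons : ℕ
  /-- the number of sides of an elementary polygon that belong to the arc system -/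
  numArcSides : Fin numPolygons → ℕ
  numArcSides_pos : ∀ i, 0 < numArcSides i
  /-- whether the side of the polygon that is not an arc is an unmarked boundary component -/
  isInfinite : Fin numPolygons → Bool
  /-- the arc side to which a given arc side is glued -/
  opp : (Σ i, Fin (numArcSides i)) → Σ i, Fin (numArcSides i)
  opp_opp : ∀ s, opp (opp s) = s
  opp_ne : ∀ s, opp s ≠ s

namespace PolygonGluing

variable (G : PolygonGluing)

/-- An oriented arc of `Γ`. Each oriented arc has exactly one elementary polygon on its right,
around which it runs clockwise, so the oriented arcs are the pairs (polygon, arc side of it); the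
arc sides of the polygon `i` are numbered `0, 1, …` in the clockwise order, starting after the
boundary side if there is one. -/
abbrev OrientedArc : Type := Σ i, Fin (G.numArcSides i)

/-- The side of the same polygon that comes after the given arc side in the clockwise order, if it
is an arc. -/
def next (s : G.OrientedArc) : Option G.OrientedArc :=
  if h : s.2.val + 1 < G.numArcSides s.1 then some ⟨s.1, ⟨s.2.val + 1, h⟩⟩
  else if G.isInfinite s.1 then some ⟨s.1, ⟨0, G.numArcSides_pos s.1⟩⟩
  else none

/-- The number of sides on the (outer) boundary circle of a polygon. -/
def numOuterSides (i : Fin G.numPolygons) : ℕ :=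
  if G.isInfinite i then G.numArcSides i else G.numArcSides i + 1

/-- The closed polygon, a disc or an annulus in the plane. -/
def Polygon (i : Fin G.numPolygons) : Type :=
  {z : ℂ // ‖z‖ ≤ 1 ∧ (G.isInfinite i = true → 1 / 2 ≤ ‖z‖)}

instance (i : Fin G.numPolygons) : TopologicalSpace (G.Polygon i) :=
  inferInstanceAs (TopologicalSpace {z : ℂ // ‖z‖ ≤ 1 ∧ (G.isInfinite i = true → 1 / 2 ≤ ‖z‖)})

/-- The clockwise parametrization of an arc side of a polygon. -/
def sidePoint (s : G.OrientedArc) (t : unitInterval) : Σ i, G.Polygon i :=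
  ⟨s.1, ⟨Complex.exp
      ((-(2 * Real.pi * ((s.2.val : ℝ) + t) / G.numOuterSides s.1) : ℝ) * Complex.I), by
    rw [Complex.norm_exp_ofReal_mul_I]; norm_num⟩⟩

/-- The gluing of the arc sides. -/
inductive Glued : (Σ i, G.Polygon i) → (Σ i, G.Polygon i) → Prop
  | side (s : G.OrientedArc) (t : unitInterval) :
      Glued (G.sidePoint s t) (G.sidePoint (G.opp s) (unitInterval.symm t))

/-- The glued surface `𝒮`. -/
def Surface : Type := Quot G.Glued

instance : TopologicalSpace G.Surface := inferInstanceAs (TopologicalSpace (Quot G.Glued))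

/-- An oriented arc as a curve in the surface. Its endpoints `curve s 0`, `curve s 1` are the
marked points `γ(0⁺)`, `γ(1⁻)`; the reverse curve is `curve (opp s)`. -/
def curve (s : G.OrientedArc) (t : unitInterval) : G.Surface := Quot.mk _ (G.sidePoint s t)

theorem curve_opp (s : G.OrientedArc) (t : unitInterval) :
    G.curve (G.opp s) t = G.curve s (unitInterval.symm t) := by
  have h := Quot.sound (PolygonGluing.Glued.side (G := G) s (unitInterval.symm t))
  rw [unitInterval.symm_symm] at h
  exact h.symm

/-- `s` ends at a marked point `p`; this is the next arc around `p` in the counterclockwise order,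
again oriented towards `p`, or `none` if one meets the boundary of the surface instead. -/
def rotate (s : G.OrientedArc) : Option G.OrientedArc := (G.next s).map G.opp

end PolygonGluing

/-- A marked ribbon surface `(𝒮, ℳ, Γ)`: the surface is connected, and every marked point lies on
its boundary, that is, turning counterclockwise around the endpoint of an arc one meets the
boundary after finitely many arcs. -/
structure MarkedRibbonSurface extends PolygonGluing where
  connected : ConnectedSpace toPolygonGluing.Surface
  marked_mem_boundary : ∀ s : toPolygonGluing.OrientedArc,
    ∃ n : ℕ, (fun o => o.bind toPolygonGluing.rotate)^[n] (some s) = none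

namespace MarkedRibbonSurface

variable (S : MarkedRibbonSurface)

/-- An oriented arc and its reverse are the same arc. -/
instance arcSetoid : Setoid S.OrientedArc where
  r s t := s = t ∨ s = S.opp t
  iseqv :=
    { refl := fun s => Or.inl rfl
      symm := by
        rintro s t (rfl | rfl)
        · exact Or.inl rfl
        · exact Or.inr (S.opp_opp t).symm
      trans := by
        rintro s t w (rfl | rfl) (rfl | rfl)
        · exact Or.inl rfl
        · exact Or.inr rfl
        · exact Or.inr rfl
        · exact Or.inl (S.opp_opp w) }

/-- The arc system `Γ`. -/
def Arc : Type := Quotient S.arcSetoid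

/-- The arc underlying an oriented arc. -/
def arc (s : S.OrientedArc) : S.Arc := Quotient.mk S.arcSetoid s

instance : Finite S.Arc := inferInstanceAs (Finite (Quotient S.arcSetoid))

instance : Fintype S.Arc := Fintype.ofFinite S.Arc

/-- The quiver of the surface: its vertices are the arcs, and it has an arrow `u ⟶ v` for every
corner of an elementary polygon formed by two sides `u`, `v` in `Γ` such that `v` follows `u` in the
counterclockwise order around the marked point at that corner. (Seen from the polygon, `v` is then
the side after `u` in the clockwise order.) An arrow is recorded by the side of the polygon that
forms its source. -/
instance : Quiver.{0} S.Arc where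
  Hom u v := {s : S.OrientedArc // S.arc s = u ∧ ∃ t, S.next s = some t ∧ S.arc t = v}

/-- The relations: the compositions `αβ` such that `α : u ⟶ v` and `β : v ⟶ w` are given by two
consecutive corners of the same elementary polygon, with consecutive sides `u`, `v`, `w`. -/
inductive IsRelation (k : Type u) [Field k] : PathAlgebra k S.Arc → Prop
  | comp {a b c : S.Arc} (α : a ⟶ b) (β : b ⟶ c) (h : S.next α.1 = some β.1) :
      IsRelation k (PathAlgebra.ofPath k (α.toPath.comp β.toPath))

/-- The ideal generated by the relations. -/
def relationIdeal (k : Type u) [Field k] : TwoSidedIdeal (PathAlgebra k S.Arc) :=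
  TwoSidedIdeal.span {x | S.IsRelation k x}

/-- The gentle algebra `A = kQ / I` of the surface. -/
abbrev GentleAlgebra (k : Type u) [Field k] : Type u := (S.relationIdeal k).ringCon.Quotient

/-- The idempotent of an arc. -/
def idem (k : Type u) [Field k] (v : S.Arc) : S.GentleAlgebra k :=
  (S.relationIdeal k).ringCon.mk' (PathAlgebra.ofPath k (Quiver.Path.nil : Quiver.Path v v))

/-- The indecomposable projective right module `e_v A` of an arc. -/
def proj (k : Type u) [Field k] (v : S.Arc) :
    Submodule (S.GentleAlgebra k)ᵐᵒᵖ (S.GentleAlgebra k) :=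
  Submodule.span _ {S.idem k v}

theorem relationIdeal_le_ker (k : Type u) [Field k] (v : S.Arc) :
    S.relationIdeal k ≤ TwoSidedIdeal.ker (PathAlgebra.character (k := k) v) := by
  refine TwoSidedIdeal.span_le.2 ?_
  rintro _ ⟨α, β, -⟩
  rw [SetLike.mem_coe, TwoSidedIdeal.mem_ker]
  exact PathAlgebra.coeffNil_ofPath_of_length_pos v _ (by simp)

/-- The ring homomorphism `A → k` that sends `e_v` to `1`, the other trivial paths and all arrows
to `0`. -/
def character (k : Type u) [Field k] (v : S.Arc) : S.GentleAlgebra k →+* k :=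
  RingCon.lift (S.relationIdeal k).ringCon (PathAlgebra.character (k := k) v) (by
    intro x y h
    have h' := S.relationIdeal_le_ker k v (((S.relationIdeal k).rel_iff x y).1 h)
    rw [TwoSidedIdeal.mem_ker, map_sub, sub_eq_zero] at h'
    exact h')

/-- The right module `M(c_simp^v)` of the simple string at the arc `v`: it is one-dimensional and
concentrated at the vertex `v`, and every arrow acts as zero. -/
def Simple (k : Type u) [Field k] (_ : S.Arc) : Type u := k

instance (k : Type u) [Field k] (v : S.Arc) : AddCommGroup (S.Simple k v) :=
  inferInstanceAs (AddCommGroup k)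

instance (k : Type u) [Field k] (v : S.Arc) : Module (S.GentleAlgebra k)ᵐᵒᵖ (S.Simple k v) :=
  Module.compHom k (S.character k v).op

/-! ### Chains of consecutive sides -/

variable {S}

/-- The arc underlying `γ` is a side of the elementary polygon `i`. -/
def IsSideOf (γ : S.OrientedArc) (i : Fin S.numPolygons) : Prop :=
  γ.1 = i ∨ (S.opp γ).1 = i

/-- At a corner of the polygon `i`, formed by the end of `γ` and the start of `δ`, the arc `δ`
follows `γ` in the counterclockwise order around the marked point (the polygon is on the right of
`γ` and `δ`). -/
def FollowsCounterclockwise (i : Fin S.numPolygons) (γ δ : S.OrientedArc) : Prop :=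
  γ.1 = i ∧ S.next γ = some δ

/-- At a corner of the polygon `i`, formed by the end of `γ` and the start of `δ`, the arc `δ`
follows `γ` in the clockwise order around the marked point (the polygon is on the left of `γ` and
`δ`, that is, on the right of the reversed arcs). -/
def FollowsClockwise (i : Fin S.numPolygons) (γ δ : S.OrientedArc) : Prop :=
  (S.opp γ).1 = i ∧ S.next (S.opp δ) = some (S.opp γ)

/-- The oriented arcs `γ 0, …, γ n` are sides of one elementary polygon, each starts where the
preceding one ends, and each follows the preceding one counterclockwise around their common
endpoint. -/
def IsCounterclockwiseChain {n : ℕ} (γ : Fin (n + 1) → S.OrientedArc) : Prop :=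
  ∃ i : Fin S.numPolygons,
    (∀ j, IsSideOf (γ j) i) ∧
    (∀ j : Fin n, S.curve (γ j.castSucc) 1 = S.curve (γ j.succ) 0) ∧
    ∀ j : Fin n, FollowsCounterclockwise i (γ j.castSucc) (γ j.succ)

/-- As `IsCounterclockwiseChain`, with the clockwise order instead of the counterclockwise one. -/
def IsClockwiseChain {n : ℕ} (γ : Fin (n + 1) → S.OrientedArc) : Prop :=
  ∃ i : Fin S.numPolygons,
    (∀ j, IsSideOf (γ j) i) ∧
    (∀ j : Fin n, S.curve (γ j.castSucc) 1 = S.curve (γ j.succ) 0) ∧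
    ∀ j : Fin n, FollowsClockwise i (γ j.castSucc) (γ j.succ)

/-- Condition (PD): a chain that cannot be prolonged at its end. -/
def SatisfiesPD {n : ℕ} (γ : Fin (n + 1) → S.OrientedArc) : Prop :=
  IsCounterclockwiseChain γ ∧
    ∀ δ : S.OrientedArc, ¬ IsCounterclockwiseChain (Fin.snoc (α := fun _ => S.OrientedArc) γ δ)

/-- Condition (ID). -/
def SatisfiesID {n : ℕ} (γ : Fin (n + 1) → S.OrientedArc) : Prop :=
  IsClockwiseChain γ ∧
    ∀ δ : S.OrientedArc, ¬ IsClockwiseChain (Fin.snoc (α := fun _ => S.OrientedArc) γ δ)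

/-- `e_{γ j} A` if `j ≤ n`, and the zero module otherwise. -/
def chainProj (k : Type u) [Field k] {n : ℕ} (γ : Fin (n + 1) → S.OrientedArc) (j : ℕ) :
    Submodule (S.GentleAlgebra k)ᵐᵒᵖ (S.GentleAlgebra k) :=
  if h : j < n + 1 then S.proj k (S.arc (γ ⟨j, h⟩)) else ⊥

/-- The terms `e_{γ 0} A`, `e_{γ 1} A ⊕ e_{γ' 1} A`, `e_{γ 2} A ⊕ e_{γ' 2} A`, …, where arcs beyond
the ends of the two chains contribute zero modules. -/
def resolutionTerm (k : Type u) [Field k] {n m : ℕ} (γ : Fin (n + 1) → S.OrientedArc)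
    (γ' : Fin (m + 1) → S.OrientedArc) (j : ℕ) :
    Submodule (S.GentleAlgebra k)ᵐᵒᵖ (S.GentleAlgebra k × S.GentleAlgebra k) :=
  (chainProj k γ j).prod (if j = 0 then ⊥ else chainProj k γ' j)

end MarkedRibbonSurface

/-! ### Minimal projective resolutions -/

/-- A submodule `N` of `M` is superfluous if `N + L = M` only for `L = M`. -/
def IsSuperfluous {R M : Type u} [Ring R] [AddCommGroup M] [Module R M] (N : Submodule R M) :
    Prop :=
  ∀ L : Submodule R M, N ⊔ L = ⊤ → L = ⊤

/-- The sequence `⋯ → P 2 → P 1 → P 0 → M → 0` with maps `d j : P (j + 1) → P j` and `ε : P 0 → M`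
is a minimal projective resolution: it is exact, its terms `P j` are projective, and each of them
maps onto the corresponding syzygy with a superfluous kernel. -/
structure IsMinimalProjectiveResolution {R M : Type u} [Ring R] [AddCommGroup M] [Module R M]
    (P : ℕ → Type u) [∀ j, AddCommGroup (P j)] [∀ j, Module R (P j)]
    (d : ∀ j, P (j + 1) →ₗ[R] P j) (ε : P 0 →ₗ[R] M) : Prop where
  projective : ∀ j, Module.Projective R (P j)
  surjective : Function.Surjective ε
  exact_zero : Function.Exact (d 0) ε
  exact_succ : ∀ j, Function.Exact (d (j + 1)) (d j)
  superfluous_zero : IsSuperfluous (LinearMap.ker ε)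
  superfluous_succ : ∀ j, IsSuperfluous (LinearMap.ker (d j))

end

/-! Every arc has two sides, so at most two arrows leave a vertex. The ideal of relations is
monomial: an element of `kQ` lies in it exactly when its coefficients at all relation-free paths
vanish (`mem_relationIdeal_iff`). Two facts follow. The right ideals generated by the two arrows
that leave a vertex `v` meet in zero, and their sum is the radical of `e_v A`. If `α` and then `β`
sit at consecutive corners of a polygon, the elements of the projective at the end of `α` that are
killed by left multiplication with `α` form exactly `βA` (`exists_eq_arrowElem_mul`).

Hence there are short exact sequences `0 → βA → eA → αA → 0`: the syzygy of `αA` is generated by the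
next arrow around the polygon. The resolution of a simple module therefore runs along the two chains
of sides that begin at the two sides of its arc. Its differentials are multiplications by arrows, so
their images lie in the radical. A relation-free path turns around a single marked point, and its
length is bounded because that point lies on the boundary of the surface. So the algebra is
finite-dimensional with nilpotent radical, and the resolution is minimal.

Dimension shifting along the same sequences gives, for `i > 0`, that `Ext^i(S_v, S_w)` is nonzero if
and only if `w` is the arc of the `i`-th successor of one of the two sides of `v`
(`subsingleton_ext_simple_iff`). The projective dimension results from fixing `v`. The injective
dimension results from fixing `w`, because over an artinian ring it can be tested on simple modules
(`hasInjectiveDimensionLT_of_simple`) and every simple module is some `S_v`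
(`exists_linearEquiv_simple`). A clockwise chain, read backwards with all arcs reversed, is a chain
of successors, so (ID) describes the longest chain that arrives at a given side. -/

open CategoryTheory Abelian

noncomputable section

/-! ### Nakayama's lemma for a nilpotent filtration. -/

section Superfluous

variable {R M : Type u} [Ring R] [AddCommGroup M] [Module R M]

/-- Substituting `M = L + F 1 • M` into itself gives `M = L + F i • M` for every `i`, and the last
term eventually vanishes. The filtration `F` plays the role of the powers of `F 1`. -/
theorem isSuperfluous_of_le_smul_top {F : ℕ → Ideal R} (h0 : F 0 = ⊤) {n : ℕ} (hn : F n = ⊥)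
    (hF : ∀ i, ∀ x ∈ F 1, ∀ y ∈ F i, x * y ∈ F (i + 1)) {N : Submodule R M}
    (hN : N ≤ F 1 • ⊤) : IsSuperfluous N := by
  intro L hL
  have h1 : L ⊔ F 1 • (⊤ : Submodule R M) = ⊤ :=
    top_le_iff.1 (hL.symm.le.trans (sup_le (hN.trans le_sup_right) le_sup_left))
  have h2 : ∀ i : ℕ, L ⊔ F i • (⊤ : Submodule R M) = ⊤ := by
    intro i
    induction i with
    | zero => simp [h0]
    | succ i ih =>
      refine top_le_iff.1 (h1.symm.le.trans ?_)
      refine sup_le le_sup_left (Submodule.smul_le.2 fun r hr m _ => ?_)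
      obtain ⟨l, hl, y, hy, rfl⟩ := Submodule.mem_sup.1 (ih.symm.le (Submodule.mem_top (x := m)))
      rw [smul_add]
      refine add_mem (Submodule.mem_sup_left (L.smul_mem r hl)) (Submodule.mem_sup_right ?_)
      refine Submodule.smul_induction_on hy (fun s hs z hz => ?_) fun y z hy hz => ?_
      · rw [smul_smul]
        exact Submodule.smul_mem_smul (hF i r hr s hs) hz
      · rw [smul_add]
        exact add_mem hy hz
  simpa [hn] using h2 n

end Superfluous

/-! ### Vanishing of Ext along short exact sequences. -/

section DimensionShift

variable {C : Type*} [Category C] [Abelian C] [HasExt.{u} C]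

/-- Dimension shifting along a short exact sequence `0 → K → P → M → 0` with `P` projective, all of
whose maps `P ⟶ X` vanish on `K`. -/
theorem subsingleton_ext_succ_iff {T : ShortComplex C} (hT : T.ShortExact) [Projective T.X₂]
    {X : C} (h : ∀ f : T.X₂ ⟶ X, T.f ≫ f = 0) (i : ℕ) :
    Subsingleton (Ext T.X₃ X (i + 1)) ↔ Subsingleton (Ext T.X₁ X i) := by
  constructor
  · intro hs
    refine subsingleton_of_forall_eq 0 fun x => ?_
    obtain ⟨y, rfl⟩ := Ext.contravariant_sequence_exact₁ hT X x (add_comm 1 i)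
      (Subsingleton.elim _ _)
    -- In degree zero the class is a map `K ⟶ X` that extends to `P`, and `h` makes it vanish; in
    -- positive degrees Ext out of `P` is zero. Without `h` the equivalence would start only at `i =
    -- 1`.
    rcases i with _ | i
    · obtain ⟨f, rfl⟩ := Ext.addEquiv₀.symm.surjective y
      simp [h f]
    · rw [Ext.eq_zero_of_projective y, Ext.comp_zero]
  · intro hs
    refine subsingleton_of_forall_eq 0 fun x => ?_
    obtain ⟨y, rfl⟩ := Ext.contravariant_sequence_exact₃ hT X x
      (Ext.eq_zero_of_projective _) (add_comm 1 i)
    rw [Subsingleton.elim y 0, Ext.comp_zero]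

theorem subsingleton_ext_of_shortExact {T : ShortComplex C} (hT : T.ShortExact) {X : C} {i : ℕ}
    (h₁ : Subsingleton (Ext T.X₁ X i)) (h₃ : Subsingleton (Ext T.X₃ X i)) :
    Subsingleton (Ext T.X₂ X i) := by
  refine subsingleton_of_forall_eq 0 fun x => ?_
  obtain ⟨y, rfl⟩ := Ext.contravariant_sequence_exact₂ hT X x (Subsingleton.elim _ _)
  rw [Subsingleton.elim y 0, Ext.comp_zero]

theorem subsingleton_ext_of_retract {Y Z : C} (r : Retract Y Z) {X : C} {i : ℕ}
    (h : Subsingleton (Ext Z X i)) : Subsingleton (Ext Y X i) := by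
  refine subsingleton_of_forall_eq 0 fun x => ?_
  rw [← x.mk₀_id_comp, ← r.retract, ← Ext.mk₀_comp_mk₀, Ext.comp_assoc_of_second_deg_zero,
    Subsingleton.elim ((Ext.mk₀ r.r).comp x _) 0, Ext.comp_zero]

theorem subsingleton_ext_zero_iff {X Y : C} : Subsingleton (Ext X Y 0) ↔ ∀ f : X ⟶ Y, f = 0 := by
  rw [Ext.addEquiv₀.toEquiv.subsingleton_congr]
  exact ⟨fun h f => Subsingleton.elim _ _, fun h => subsingleton_of_forall_eq 0 h⟩

end DimensionShift

/-! ### Injective dimension over artinian rings. -/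

section InjectiveDimension

variable {R : Type u} [Ring R]

theorem shortExact_of_submodule {M : Type u} [AddCommGroup M] [Module R M] (N : Submodule R M) :
    (ShortComplex.mk (ModuleCat.ofHom N.subtype) (ModuleCat.ofHom N.mkQ) (by
      ext x; simp)).ShortExact :=
  ModuleCat.shortComplex_shortExact _ (LinearMap.exact_subtype_mkQ N) N.injective_subtype
    N.mkQ_surjective

/-- Dévissage along a composition series: vanishing of Ext on the two ends of a short exact sequence
gives vanishing in the middle. -/
theorem subsingleton_ext_of_isFiniteLength {X : ModuleCat.{u} R} {n : ℕ}
    (h : ∀ (T : Type u) [AddCommGroup T] [Module R T] [IsSimpleModule R T],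
      Subsingleton (Ext (ModuleCat.of R T) X n))
    {M : Type u} [AddCommGroup M] [Module R M] (hM : IsFiniteLength R M) :
    Subsingleton (Ext (ModuleCat.of R M) X n) := by
  induction hM with
  | of_subsingleton =>
    refine subsingleton_of_forall_eq 0 fun x => ?_
    rw [← x.mk₀_id_comp, (ModuleCat.isZero_of_subsingleton _).eq_of_src (𝟙 _) 0, Ext.mk₀_zero,
      Ext.zero_comp]
  | @of_simple_quotient M _ _ N _ _ ih =>
    exact subsingleton_ext_of_shortExact (shortExact_of_submodule N) ih (h _)

/-- Over an artinian ring, the injective dimension can be tested on simple modules. -/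
theorem hasInjectiveDimensionLT_of_simple [IsArtinianRing R] (n : ℕ) (X : ModuleCat.{u} R)
    (h : ∀ (T : Type u) [AddCommGroup T] [Module R T] [IsSimpleModule R T],
      Subsingleton (Ext (ModuleCat.of R T) X (n + 1))) :
    HasInjectiveDimensionLT X (n + 1) := by
  induction n generalizing X with
  | zero =>
    rw [zero_add, ← injective_iff_hasInjectiveDimensionLT_one]
    suffices Module.Baer R X by
      have := this.injective
      exact Module.injective_object_of_injective_module R X
    intro I g
    -- Baer's criterion: the obstruction to extending `g` from `I` to `R` is a class in `Ext¹(R/I,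
    -- X)`, and `R/I` has finite length.
    have hI : Subsingleton (Ext (ModuleCat.of R (R ⧸ I)) X 1) :=
      subsingleton_ext_of_isFiniteLength h
        (isFiniteLength_iff_isNoetherian_isArtinian.2 ⟨inferInstance, inferInstance⟩)
    obtain ⟨x, hx⟩ := Ext.contravariant_sequence_exact₁ (shortExact_of_submodule I) X
      (Ext.mk₀ (ModuleCat.ofHom g)) (add_comm 1 0) (hI.elim _ _)
    obtain ⟨f, rfl⟩ := Ext.addEquiv₀.symm.surjective x
    refine ⟨f.hom, fun r hr => ?_⟩
    have h1 : ModuleCat.ofHom I.subtype ≫ f = ModuleCat.ofHom g := by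
      apply Ext.addEquiv₀.symm.injective
      simpa using hx
    exact congrArg (fun φ => φ.hom ⟨r, hr⟩) h1
  | succ n ih =>
    -- Embedding `X` into an injective object and passing to the cokernel lowers by one both the
    -- degree of Ext and the dimension to be bounded.
    let ⟨I, _, f, _⟩ := EnoughInjectives.presentation X
    let T : ShortComplex (ModuleCat.{u} R) :=
      ShortComplex.mk f (Limits.cokernel.π f) (Limits.cokernel.condition f)
    have hT : T.ShortExact := { exact := ShortComplex.exact_cokernel f }
    have : Injective T.X₂ := ‹Injective I›
    refine (hT.hasInjectiveDimensionLT_X₃_iff n inferInstance).1 (ih _ fun Y _ _ _ => ?_)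
    refine subsingleton_of_forall_eq 0 fun x => ?_
    obtain ⟨y, rfl⟩ := Ext.covariant_sequence_exact₃ _ hT x rfl ((h Y).elim _ _)
    rw [Ext.eq_zero_of_injective y, Ext.zero_comp]

end InjectiveDimension

namespace PolygonGluing

variable {G : PolygonGluing}

/-- The successor stays in its polygon and shifts the index by one, cyclically if the polygon is an
annulus. Predecessors are thus unique, which is what bounds the chains arriving at a given side. -/
theorem next_injective {s s' t : G.OrientedArc} (h : G.next s = some t) (h' : G.next s' = some t) :
    s = s' := by
  obtain ⟨i, a, ha⟩ := s
  obtain ⟨j, b, hb⟩ := s'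
  simp only [next] at h h'
  split_ifs at h h' <;> cases h <;> cases h' <;> grind

end PolygonGluing

/-! ### Coefficients of paths. -/

namespace PathAlgebra

variable {k : Type u} [Field k] {V : Type} [Quiver.{0} V]

/-- The coefficient of a path. -/
def coeff {a b : V} (p : Quiver.Path a b) : PathAlgebra k V →ₗ[k] k :=
  Finsupp.lapply ⟨a, b, p⟩

theorem coeff_ofPath_self {a b : V} (p : Quiver.Path a b) : coeff p (ofPath k p) = 1 :=
  Finsupp.single_eq_same

theorem coeff_ofPath_of_ne {a b c d : V} {p : Quiver.Path a b} {q : Quiver.Path c d}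
    (h : (⟨c, d, q⟩ : Σ a b : V, Quiver.Path a b) ≠ ⟨a, b, p⟩) : coeff p (ofPath k q) = 0 :=
  Finsupp.single_eq_of_ne h.symm

theorem mem_of_forall_coeff {N : Submodule k (PathAlgebra k V)} {x : PathAlgebra k V}
    (h : ∀ {a b : V} (p : Quiver.Path a b), coeff p x ≠ 0 → ofPath k p ∈ N) : x ∈ N := by
  have h1 : x = Finsupp.sum (M := k) (show (Σ a b : V, Quiver.Path a b) →₀ k from x)
      fun p c => (Finsupp.single p c : (Σ a b : V, Quiver.Path a b) →₀ k) :=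
    (Finsupp.sum_single _).symm
  rw [h1]
  refine N.sum_mem fun p hp => ?_
  have h2 := N.smul_mem (coeff p.2.2 x) (h p.2.2 (Finsupp.mem_support_iff.1 hp))
  have h3 : coeff p.2.2 x • ofPath k p.2.2 =
      (Finsupp.single p (coeff p.2.2 x) : (Σ a b : V, Quiver.Path a b) →₀ k) :=
    Finsupp.smul_single_one p _
  rw [h3] at h2
  exact h2

/-- Prefixing with `e` is injective on paths, so `p` is the only path in `x` that contributes. -/
theorem coeff_comp_ofPath_mul {a b c : V} (e : Quiver.Path a b) (p : Quiver.Path b c)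
    (x : PathAlgebra k V) : coeff (e.comp p) (ofPath k e * x) = coeff p x := by
  induction x using induction with
  | zero => rw [mul_zero', map_zero, map_zero]
  | add x y hx hy => rw [mul_add', map_add, map_add, hx, hy]
  | @smul r a' b' q =>
    rw [mul_smul', map_smul, map_smul]
    congr 1
    by_cases h : a' = b
    · subst h
      rw [ofPath_mul_ofPath]
      by_cases hpq : (⟨a', b', q⟩ : Σ a b : V, Quiver.Path a b) = ⟨a', c, p⟩
      · cases hpq
        rw [coeff_ofPath_self, coeff_ofPath_self]
      · rw [coeff_ofPath_of_ne hpq, coeff_ofPath_of_ne]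
        intro h
        obtain rfl : b' = c := by simpa using congrArg (fun z => z.2.1) h
        rw [Sigma.mk.injEq, heq_eq_eq, Sigma.mk.injEq, heq_eq_eq, Quiver.Path.comp_inj_right] at h
        exact hpq (by rw [h.2.2])
    · rw [ofPath_mul_ofPath_of_ne _ _ h, map_zero, coeff_ofPath_of_ne]
      rintro ⟨⟩
      exact h rfl

theorem coeff_ofPath_mul_of_forall_ne {a b c d : V} (e : Quiver.Path a b) (q : Quiver.Path c d)
    (h : ∀ p : Quiver.Path b d,
      (⟨a, d, e.comp p⟩ : Σ a b : V, Quiver.Path a b) ≠ ⟨c, d, q⟩) (x : PathAlgebra k V) :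
    coeff q (ofPath k e * x) = 0 := by
  induction x using induction with
  | zero => rw [mul_zero', map_zero]
  | add x y hx hy => rw [mul_add', map_add, hx, hy, add_zero]
  | @smul r a' b' p =>
    rw [mul_smul', map_smul]
    by_cases hb : a' = b
    · subst hb
      rw [ofPath_mul_ofPath, coeff_ofPath_of_ne, smul_zero]
      intro h'
      obtain rfl : b' = d := by simpa using congrArg (fun z => z.2.1) h'
      exact h p h'
    · rw [ofPath_mul_ofPath_of_ne _ _ hb, map_zero, smul_zero]

end PathAlgebra

/-! ### Paths as lists of sides, and the monomial ideal of relations. -/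

namespace MarkedRibbonSurface

open PathAlgebra

variable {S : MarkedRibbonSurface}

theorem arc_opp (s : S.OrientedArc) : S.arc (S.opp s) = S.arc s :=
  Quotient.sound (Or.inr rfl)

theorem eq_or_eq_opp_of_arc_eq {s t : S.OrientedArc} (h : S.arc s = S.arc t) :
    s = t ∨ s = S.opp t :=
  Quotient.exact h

theorem exists_arc_eq (v : S.Arc) : ∃ s, S.arc s = v := Quotient.exists_rep v

/-- The sequence of oriented arcs that record the arrows of a path. -/
def arrows {a : S.Arc} : ∀ {b : S.Arc}, Quiver.Path a b → List S.OrientedArc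
  | _, .nil => []
  | _, .cons p e => arrows p ++ [e.1]

@[simp]
theorem arrows_nil {a : S.Arc} : arrows (Quiver.Path.nil : Quiver.Path a a) = [] := rfl

@[simp]
theorem arrows_cons {a b c : S.Arc} (p : Quiver.Path a b) (e : b ⟶ c) :
    arrows (p.cons e) = arrows p ++ [e.1] := rfl

@[simp]
theorem arrows_toPath {a b : S.Arc} (e : a ⟶ b) : arrows e.toPath = [e.1] := rfl

@[simp]
theorem arrows_comp {a b c : S.Arc} (p : Quiver.Path a b) (q : Quiver.Path b c) :
    arrows (p.comp q) = arrows p ++ arrows q := by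
  induction q with
  | nil => simp
  | cons q e ih => simp [ih]

@[simp]
theorem length_arrows {a b : S.Arc} (p : Quiver.Path a b) : (arrows p).length = p.length := by
  induction p with
  | nil => rfl
  | cons p e ih => simp [ih]

/-- An arrow is recorded by its source side alone; its target is recovered because `next` is a
function. -/
theorem arrows_injective {a b c : S.Arc} {p : Quiver.Path a b} {q : Quiver.Path a c}
    (h : arrows p = arrows q) : (⟨b, p⟩ : Σ b, Quiver.Path a b) = ⟨c, q⟩ := by
  induction p generalizing c with
  | nil =>
    cases q with
    | nil => rfl
    | cons q f => simp at h
  | cons p e ih =>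
    cases q with
    | nil => simp at h
    | cons q f =>
      simp only [arrows_cons, List.append_singleton_inj] at h
      cases ih h.1
      obtain ⟨s, rfl, t, ht, rfl⟩ := e
      obtain ⟨s', hs', t', ht', rfl⟩ := f
      obtain rfl : s = s' := h.2
      cases ht.symm.trans ht'
      rfl

/-- The arrow given by two consecutive sides of an elementary polygon. -/
def arrow {s t : S.OrientedArc} (h : S.next s = some t) : S.arc s ⟶ S.arc t :=
  ⟨s, rfl, t, h, rfl⟩

/-- `Quiver.Path` grows at its end, whereas right ideals are governed by the first arrow of a path;
this splits off that first arrow. -/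
theorem exists_eq_arrow_comp {a b : S.Arc} (p : Quiver.Path a b) :
    (∃ h : a = b, p = h ▸ Quiver.Path.nil) ∨
      ∃ (s t : S.OrientedArc) (h : S.next s = some t) (hs : S.arc s = a)
        (q : Quiver.Path (S.arc t) b), p = hs ▸ (arrow h).toPath.comp q := by
  induction p with
  | nil => exact Or.inl ⟨rfl, rfl⟩
  | cons p e ih =>
    right
    rcases ih with ⟨rfl, rfl⟩ | ⟨s, t, h, rfl, q, rfl⟩
    · obtain ⟨s, rfl, t, h, rfl⟩ := e
      exact ⟨s, t, h, rfl, .nil, rfl⟩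
    · exact ⟨s, t, h, rfl, q.cons e, rfl⟩

theorem arc_eq_of_head?_arrows {a b : S.Arc} {p : Quiver.Path a b} {s : S.OrientedArc}
    (h : (arrows p).head? = some s) : S.arc s = a := by
  rcases exists_eq_arrow_comp p with ⟨rfl, rfl⟩ | ⟨s', t, hs, rfl, q, rfl⟩
  · simp at h
  · simp [arrow] at h
    rw [h]

/-- A path avoids the relations if it contains no two consecutive corners of one polygon. -/
def AvoidsRelations {a b : S.Arc} (p : Quiver.Path a b) : Prop :=
  (arrows p).IsChain fun s t => S.next s ≠ some t

section Ideal

variable {k : Type u} [Field k]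

theorem smul_mem_relationIdeal (c : k) {x : PathAlgebra k S.Arc} (h : x ∈ S.relationIdeal k) :
    c • x ∈ S.relationIdeal k := by
  have := (S.relationIdeal k).mul_mem_left (c • 1) x h
  rwa [PathAlgebra.smul_mul', one_mul'] at this

variable (S k) in
/-- The ideal generated by the relations, as a subspace. -/
def relationSubmodule : Submodule k (PathAlgebra k S.Arc) where
  carrier := {x | x ∈ S.relationIdeal k}
  add_mem' := (S.relationIdeal k).add_mem
  zero_mem' := (S.relationIdeal k).zero_mem
  smul_mem' c _ h := smul_mem_relationIdeal c h

/-- Induction on the last arrow: if the relation is not already contained in the shorter path, it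
consists of the last two arrows. -/
theorem ofPath_mem_relationIdeal {a b : S.Arc} {p : Quiver.Path a b} (h : ¬ AvoidsRelations p) :
    ofPath k p ∈ S.relationIdeal k := by
  induction p with
  | nil => simp [AvoidsRelations] at h
  | @cons b c p e ih =>
    by_cases hp : AvoidsRelations p
    · cases p with
      | nil => simp [AvoidsRelations] at h
      | @cons d _ q f =>
        have h1 : S.next f.1 = some e.1 := by
          by_contra h1
          refine h ?_
          simp only [AvoidsRelations, arrows_cons, List.append_assoc] at hp ⊢
          rw [List.isChain_append] at hp ⊢
          refine ⟨hp.1, ?_, ?_⟩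
          · simpa using h1
          · simpa using hp.2.2
        have h2 : ofPath k ((q.cons f).cons e) =
            ofPath k q * ofPath k (f.toPath.comp e.toPath) := by
          rw [ofPath_mul_ofPath]; rfl
        rw [h2]
        exact TwoSidedIdeal.mul_mem_left _ _ _
          (TwoSidedIdeal.subset_span (IsRelation.comp f e h1))
    · have h2 : ofPath k (p.cons e) = ofPath k p * ofPath k e.toPath := by
        rw [ofPath_mul_ofPath]; rfl
      rw [h2]
      exact TwoSidedIdeal.mul_mem_right _ _ _ (ih hp)

variable (S k) in
/-- The subspace spanned by the paths that contain a relation. -/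
def relationSpan : Submodule k (PathAlgebra k S.Arc) :=
  Submodule.span k {x | ∃ (a b : S.Arc) (p : Quiver.Path a b), ¬ AvoidsRelations p ∧
    x = ofPath k p}

theorem mul_mem_relationSpan_left (x : PathAlgebra k S.Arc) {y : PathAlgebra k S.Arc}
    (hy : y ∈ relationSpan S k) : x * y ∈ relationSpan S k := by
  induction hy using Submodule.span_induction with
  | zero => rw [mul_zero']; exact zero_mem _
  | add y z _ _ hy hz => rw [mul_add']; exact add_mem hy hz
  | smul c y _ hy => rw [mul_smul']; exact Submodule.smul_mem _ c hy
  | mem y hy =>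
    obtain ⟨a, b, p, hp, rfl⟩ := hy
    induction x using induction with
    | zero => rw [zero_mul']; exact zero_mem _
    | add y z hy hz => rw [add_mul']; exact add_mem hy hz
    | @smul c a' b' q =>
      rw [PathAlgebra.smul_mul']
      refine Submodule.smul_mem _ c ?_
      by_cases h : a = b'
      · subst h
        rw [ofPath_mul_ofPath]
        refine Submodule.subset_span ⟨_, _, _, fun h => hp ?_, rfl⟩
        rw [AvoidsRelations, arrows_comp] at h
        exact h.right_of_append
      · rw [ofPath_mul_ofPath_of_ne _ _ h]
        exact zero_mem _

theorem mul_mem_relationSpan_right {x : PathAlgebra k S.Arc} (hx : x ∈ relationSpan S k)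
    (y : PathAlgebra k S.Arc) : x * y ∈ relationSpan S k := by
  induction hx using Submodule.span_induction with
  | zero => rw [zero_mul']; exact zero_mem _
  | add y z _ _ hy hz => rw [add_mul']; exact add_mem hy hz
  | smul c y _ hy => rw [PathAlgebra.smul_mul']; exact Submodule.smul_mem _ c hy
  | mem x hx =>
    obtain ⟨a, b, p, hp, rfl⟩ := hx
    induction y using induction with
    | zero => rw [mul_zero']; exact zero_mem _
    | add y z hy hz => rw [mul_add']; exact add_mem hy hz
    | @smul c a' b' q =>
      rw [mul_smul']
      refine Submodule.smul_mem _ c ?_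
      by_cases h : a' = b
      · subst h
        rw [ofPath_mul_ofPath]
        refine Submodule.subset_span ⟨_, _, _, fun h => hp ?_, rfl⟩
        rw [AvoidsRelations, arrows_comp] at h
        exact h.left_of_append
      · rw [ofPath_mul_ofPath_of_ne _ _ h]
        exact zero_mem _

/-- A path containing a relation still contains it after being extended on either side, so the span
is a two-sided ideal containing the generators. -/
theorem mem_relationSpan_of_mem {x : PathAlgebra k S.Arc} (h : x ∈ S.relationIdeal k) :
    x ∈ relationSpan S k := by
  let I : TwoSidedIdeal (PathAlgebra k S.Arc) := TwoSidedIdeal.mk' (relationSpan S k)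
    (zero_mem _) add_mem neg_mem (mul_mem_relationSpan_left _)
    (fun h => mul_mem_relationSpan_right h _)
  have hI : S.relationIdeal k ≤ I := by
    refine TwoSidedIdeal.span_le.2 ?_
    rintro _ ⟨α, β, h⟩
    refine (TwoSidedIdeal.mem_mk' _ _ _ _ _ _ _).2 ?_
    refine Submodule.subset_span ⟨_, _, _, ?_, rfl⟩
    simpa [AvoidsRelations] using h
  exact (TwoSidedIdeal.mem_mk' _ _ _ _ _ _ _).1 (hI h)

/-- The ideal of relations is spanned by the paths that contain a relation. -/
theorem mem_relationIdeal_iff {x : PathAlgebra k S.Arc} :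
    x ∈ S.relationIdeal k ↔
      ∀ {a b : S.Arc} (p : Quiver.Path a b), AvoidsRelations p → coeff p x = 0 := by
  constructor
  · intro h a b p hp
    have h1 : relationSpan S k ≤ LinearMap.ker (coeff p) := by
      refine Submodule.span_le.2 ?_
      rintro _ ⟨c, d, q, hq, rfl⟩
      refine coeff_ofPath_of_ne ?_
      rintro ⟨⟩
      exact hq hp
    exact h1 (mem_relationSpan_of_mem h)
  · intro h
    have : x ∈ relationSubmodule S k := mem_of_forall_coeff fun p hp =>
      ofPath_mem_relationIdeal fun hp' => hp (h p hp')
    exact this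

end Ideal

end MarkedRibbonSurface

/-! ### Multiplication by arrows in the gentle algebra. -/

namespace MarkedRibbonSurface

open PathAlgebra

variable {S : MarkedRibbonSurface} (k : Type u) [Field k]

/-- The arrow that starts at the end of a side of an elementary polygon, as an element of the path
algebra; zero if there is no such arrow. -/
def arrowPath (s : S.OrientedArc) : PathAlgebra k S.Arc :=
  match h : S.next s with
  | some _ => ofPath k (arrow h).toPath
  | none => 0

theorem arrowPath_of_some {s t : S.OrientedArc} (h : S.next s = some t) :
    arrowPath k s = ofPath k (arrow h).toPath := by
  unfold arrowPath
  split
  · rename_i t' h'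
    cases h.symm.trans h'
    rfl
  · rename_i h'
    cases h.symm.trans h'

theorem arrowPath_of_none {s : S.OrientedArc} (h : S.next s = none) : arrowPath k s = 0 := by
  unfold arrowPath
  split
  · rename_i t' h'
    cases h.symm.trans h'
  · rfl

variable {k}

theorem coeff_arrowPath_mul_of_ne {s : S.OrientedArc} {a b : S.Arc} (p : Quiver.Path a b)
    (h : (arrows p).head? ≠ some s) (x : PathAlgebra k S.Arc) :
    coeff p (arrowPath k s * x) = 0 := by
  rcases hs : S.next s with _ | t
  · rw [arrowPath_of_none k hs, zero_mul', map_zero]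
  · rw [arrowPath_of_some k hs]
    refine coeff_ofPath_mul_of_forall_ne _ _ (fun q hq => h ?_) x
    cases hq
    rw [arrows_comp]
    rfl

/-- No path begins with both `s` and `s'`, and membership in the ideal is tested path by path, so
the two summands do not interact. In the quotient, the two right ideals meet in zero. -/
theorem arrowPath_mul_mem_of_add_mem {s s' : S.OrientedArc} (hs : s ≠ s')
    {x y : PathAlgebra k S.Arc}
    (h : arrowPath k s * x + arrowPath k s' * y ∈ S.relationIdeal k) :
    arrowPath k s * x ∈ S.relationIdeal k := by
  rw [mem_relationIdeal_iff] at h ⊢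
  intro a b p hp
  by_cases hps : (arrows p).head? = some s
  · have h1 := h p hp
    rwa [map_add, coeff_arrowPath_mul_of_ne (s := s') p (by rw [hps]; simpa using hs),
      add_zero] at h1
  · exact coeff_arrowPath_mul_of_ne p hps x

/-- Here `t'` is the other side of the arc of `t`, so `s` followed by `t'` is not a relation, and
prefixing `s` to a relation-free path that begins with `t'` creates none. Comparing coefficients,
left multiplication by `s` loses nothing on the trivial path and on paths beginning with `t'`. -/
theorem arrowPath_mul_mem_of_mul_mem {s t t' : S.OrientedArc} (hs : S.next s = some t)
    (ht : S.arc t' = S.arc t) (htt' : t' ≠ t) {x : PathAlgebra k S.Arc} {c : k}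
    (h : c • arrowPath k s + arrowPath k s * (arrowPath k t' * x) ∈ S.relationIdeal k) :
    c = 0 ∧ arrowPath k t' * x ∈ S.relationIdeal k := by
  rw [mem_relationIdeal_iff] at h
  rw [arrowPath_of_some k hs] at h
  have hc : c = 0 := by
    have h1 := h ((arrow hs).toPath.comp .nil) (by simp [AvoidsRelations])
    rw [map_add, coeff_comp_ofPath_mul, coeff_arrowPath_mul_of_ne _ (by simp), map_smul,
      Quiver.Path.comp_nil, coeff_ofPath_self] at h1
    simpa using h1
  refine ⟨hc, ?_⟩
  rw [mem_relationIdeal_iff]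
  intro a b p hp
  by_cases hpt : (arrows p).head? = some t'
  · obtain rfl : S.arc t = a := ht.symm.trans (arc_eq_of_head?_arrows hpt)
    have h1 := h ((arrow hs).toPath.comp p) (by
      rw [AvoidsRelations, arrows_comp, arrows_toPath, List.singleton_append, List.isChain_cons]
      refine ⟨fun r hr => ?_, hp⟩
      rw [hpt] at hr
      cases hr
      intro h2
      exact htt' (Option.some.inj (h2.symm.trans hs)))
    rwa [hc, zero_smul, zero_add, coeff_comp_ofPath_mul] at h1
  · exact coeff_arrowPath_mul_of_ne p hpt x

variable (S k) in
/-- The projection from the path algebra to the gentle algebra. -/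
def toGentle : PathAlgebra k S.Arc →+* S.GentleAlgebra k := (S.relationIdeal k).ringCon.mk'

theorem toGentle_surjective : Function.Surjective (toGentle S k) :=
  RingCon.mk'_surjective _

theorem toGentle_eq_zero_iff {x : PathAlgebra k S.Arc} :
    toGentle S k x = 0 ↔ x ∈ S.relationIdeal k := by
  rw [TwoSidedIdeal.mem_iff]
  exact RingCon.eq (c := (S.relationIdeal k).ringCon) (a := x) (b := 0)

theorem toGentle_smul (c : k) (x : PathAlgebra k S.Arc) :
    toGentle S k (c • x) = c • toGentle S k x := rfl

variable (k) in
/-- The arrow that starts at the end of a side of an elementary polygon, as an element of the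
gentle algebra; zero if there is no such arrow. -/
def arrowElem (s : S.OrientedArc) : S.GentleAlgebra k := toGentle S k (arrowPath k s)

theorem idem_eq (v : S.Arc) :
    S.idem k v = toGentle S k (ofPath k (Quiver.Path.nil : Quiver.Path v v)) := rfl

theorem idem_mul_idem (v : S.Arc) : S.idem k v * S.idem k v = S.idem k v := by
  rw [idem_eq, ← map_mul, ofPath_mul_ofPath, Quiver.Path.nil_comp]

theorem sum_idem : ∑ v, S.idem k v = 1 := by
  rw [← map_one (toGentle S k), one_def, map_sum]
  rfl

theorem arrowElem_of_none {s : S.OrientedArc} (h : S.next s = none) : arrowElem k s = 0 := by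
  rw [arrowElem, arrowPath_of_none k h, map_zero]

theorem idem_mul_arrowElem (s : S.OrientedArc) :
    S.idem k (S.arc s) * arrowElem k s = arrowElem k s := by
  rcases hs : S.next s with _ | t
  · rw [arrowElem_of_none hs, mul_zero]
  · rw [idem_eq, arrowElem, ← map_mul, arrowPath_of_some k hs, ofPath_mul_ofPath,
      Quiver.Path.nil_comp]

theorem arrowElem_mul_idem {s t : S.OrientedArc} (hs : S.next s = some t) :
    arrowElem k s * S.idem k (S.arc t) = arrowElem k s := by
  rw [idem_eq, arrowElem, ← map_mul, arrowPath_of_some k hs, ofPath_mul_ofPath,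
    Quiver.Path.comp_nil]

theorem arrowElem_mul_arrowElem {s t : S.OrientedArc} (hs : S.next s = some t) :
    arrowElem k s * arrowElem k t = 0 := by
  rcases ht : S.next t with _ | r
  · rw [arrowElem_of_none ht, mul_zero]
  · rw [arrowElem, arrowElem, ← map_mul, arrowPath_of_some k hs, arrowPath_of_some k ht,
      ofPath_mul_ofPath, toGentle_eq_zero_iff]
    exact TwoSidedIdeal.subset_span (IsRelation.comp _ _ hs)

theorem arrowElem_mul_eq_zero_of_add {s s' : S.OrientedArc} (hs : s ≠ s')
    {x y : S.GentleAlgebra k} (h : arrowElem k s * x + arrowElem k s' * y = 0) :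
    arrowElem k s * x = 0 := by
  obtain ⟨x, rfl⟩ := toGentle_surjective x
  obtain ⟨y, rfl⟩ := toGentle_surjective y
  rw [arrowElem, arrowElem, ← map_mul, ← map_mul, ← map_add, toGentle_eq_zero_iff] at h
  rw [arrowElem, ← map_mul, toGentle_eq_zero_iff]
  exact arrowPath_mul_mem_of_add_mem hs h

/-- A path starting at an arc is trivial or begins with the arrow of one of the two sides of that
arc. -/
theorem exists_idem_mul_eq (s : S.OrientedArc) (x : S.GentleAlgebra k) :
    ∃ (c : k) (y z : S.GentleAlgebra k), S.idem k (S.arc s) * x =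
      c • S.idem k (S.arc s) + arrowElem k s * y + arrowElem k (S.opp s) * z := by
  obtain ⟨x, rfl⟩ := toGentle_surjective x
  induction x using induction with
  | zero => exact ⟨0, 0, 0, by simp⟩
  | add x y hx hy =>
    obtain ⟨c, y, z, h⟩ := hx
    obtain ⟨c', y', z', h'⟩ := hy
    exact ⟨c + c', y + y', z + z', by rw [map_add, mul_add, h, h', add_smul]; noncomm_ring⟩
  | @smul r a b p =>
    by_cases ha : a = S.arc s
    · rcases exists_eq_arrow_comp p with ⟨rfl, rfl⟩ | ⟨s', t, hs, rfl, q, rfl⟩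
      · subst ha
        refine ⟨r, 0, 0, ?_⟩
        rw [toGentle_smul, mul_smul_comm]
        simp only [mul_zero, add_zero]
        congr 1
        exact idem_mul_idem _
      · have h1 : S.idem k (S.arc s) * toGentle S k (r • ofPath k ((arrow hs).toPath.comp q)) =
            arrowElem k s' * (r • toGentle S k (ofPath k q)) := by
          rw [toGentle_smul, mul_smul_comm, mul_smul_comm, ← ofPath_mul_ofPath,
            ← arrowPath_of_some, map_mul, ← mul_assoc, ← ha]
          exact congrArg (fun z => r • (z * _)) (idem_mul_arrowElem s')
        rcases eq_or_eq_opp_of_arc_eq ha with rfl | rfl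
        · exact ⟨0, r • toGentle S k (ofPath k q), 0, by simpa using h1⟩
        · exact ⟨0, 0, r • toGentle S k (ofPath k q), by simpa using h1⟩
    · refine ⟨0, 0, 0, ?_⟩
      rw [idem_eq, ← map_mul, mul_smul', ofPath_mul_ofPath_of_ne _ _ ha]
      simp

/-- The annihilator computation behind all syzygies. Of the three parts of `x`, the one beginning
with `t` is killed by the relation, while the trivial part and the part beginning with `S.opp t` are
mapped injectively and must vanish. -/
theorem exists_eq_arrowElem_mul {s t : S.OrientedArc} (hs : S.next s = some t)
    {x : S.GentleAlgebra k} (hx : S.idem k (S.arc t) * x = x) (h : arrowElem k s * x = 0) :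
    ∃ y, x = arrowElem k t * y := by
  obtain ⟨c, y, z, h1⟩ := exists_idem_mul_eq t x
  rw [hx] at h1
  rw [h1, mul_add, mul_add, mul_smul_comm, arrowElem_mul_idem hs, ← mul_assoc,
    arrowElem_mul_arrowElem hs, zero_mul, add_zero] at h
  obtain ⟨z, rfl⟩ := toGentle_surjective z
  simp only [arrowElem, ← map_mul] at h
  rw [← toGentle_smul, ← map_add, toGentle_eq_zero_iff] at h
  obtain ⟨rfl, h2⟩ := arrowPath_mul_mem_of_mul_mem hs (arc_opp t) (S.opp_ne t) h
  refine ⟨y, ?_⟩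
  rw [h1, arrowElem, arrowElem, ← map_mul _ _ z, toGentle_eq_zero_iff.2 h2, zero_smul, zero_add,
    add_zero]

/-! ### Characters -/

theorem character_toGentle (v : S.Arc) (x : PathAlgebra k S.Arc) :
    S.character k v (toGentle S k x) = coeffNil v x := rfl

theorem character_idem_self (v : S.Arc) : S.character k v (S.idem k v) = 1 := by
  rw [idem_eq, character_toGentle, coeffNil_nil_self]

theorem character_idem_of_ne {v w : S.Arc} (h : w ≠ v) : S.character k v (S.idem k w) = 0 := by
  rw [idem_eq, character_toGentle, coeffNil_nil_of_ne h]

theorem character_arrowElem (v : S.Arc) (s : S.OrientedArc) :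
    S.character k v (arrowElem k s) = 0 := by
  rcases hs : S.next s with _ | t
  · rw [arrowElem_of_none hs, map_zero]
  · rw [arrowElem, character_toGentle, arrowPath_of_some k hs,
      coeffNil_ofPath_of_length_pos _ _ (by simp)]

theorem character_smul (v : S.Arc) (c : k) (x : S.GentleAlgebra k) :
    S.character k v (c • x) = c * S.character k v x := by
  obtain ⟨x, rfl⟩ := toGentle_surjective x
  rw [← toGentle_smul, character_toGentle, character_toGentle, map_smul, smul_eq_mul]

theorem exists_eq_of_character_eq_zero {s : S.OrientedArc} {x : S.GentleAlgebra k}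
    (hx : S.idem k (S.arc s) * x = x) (h : S.character k (S.arc s) x = 0) :
    ∃ y z, x = arrowElem k s * y + arrowElem k (S.opp s) * z := by
  obtain ⟨c, y, z, h1⟩ := exists_idem_mul_eq s x
  rw [hx] at h1
  have h2 := congrArg (S.character k (S.arc s)) h1
  rw [h, map_add, map_add, map_mul, map_mul, character_arrowElem, character_arrowElem,
    character_smul, character_idem_self] at h2
  obtain rfl : c = 0 := by simpa using h2.symm
  exact ⟨y, z, by rw [h1, zero_smul, zero_add]⟩

/-! ### The filtration by path length -/

/-- If `t` is the successor of `f`, the next arrow is recorded by `t` or by `S.opp t`. The first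
choice is a relation and the second is `S.rotate f`, so a relation-free path turns around one marked
point. -/
theorem iterate_rotate_of_avoidsRelations {a b c : S.Arc} {p : Quiver.Path a b} {e : b ⟶ c}
    (h : AvoidsRelations (p.cons e)) :
    ∃ s, (fun o => o.bind S.rotate)^[p.length] (some s) = some e.1 := by
  induction p generalizing c with
  | nil => exact ⟨e.1, rfl⟩
  | @cons b d q f ih =>
    have h' := h
    rw [AvoidsRelations, arrows_cons] at h
    obtain ⟨s, hs⟩ := ih h.left_of_append
    refine ⟨s, ?_⟩
    rw [Quiver.Path.length_cons, Function.iterate_succ_apply', hs]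
    obtain ⟨f, rfl, t, ht, rfl⟩ := f
    have h1 : S.next f ≠ some e.1 := by
      rw [arrows_cons, List.append_assoc, List.isChain_append] at h
      simpa using h.2.1
    rcases eq_or_eq_opp_of_arc_eq e.2.1 with h2 | h2
    · exact absurd (ht.trans (congrArg some h2.symm)) h1
    · change S.rotate f = some e.1
      rw [PolygonGluing.rotate, ht, h2]
      rfl

variable (S) in
theorem exists_iterate_rotate_eq_none :
    ∃ N : ℕ, ∀ s : S.OrientedArc, (fun o => o.bind S.rotate)^[N] (some s) = none := by
  choose n hn using S.marked_mem_boundary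
  -- The sum dominates each `n s`, and `none` is fixed by further rotation.
  refine ⟨∑ s, n s, fun s => ?_⟩
  have h1 : ∀ i, (fun o : Option S.OrientedArc => o.bind S.rotate)^[i] none = none := fun i =>
    Function.iterate_fixed rfl i
  rw [← Nat.sub_add_cancel (Finset.single_le_sum (f := n) (fun _ _ => Nat.zero_le _)
    (Finset.mem_univ s)), Function.iterate_add_apply, hn, h1]

variable (S) in
theorem exists_not_avoidsRelations : ∃ N : ℕ, ∀ {a b : S.Arc} (p : Quiver.Path a b),
    N ≤ p.length → ¬ AvoidsRelations p := by
  obtain ⟨N, hN⟩ := exists_iterate_rotate_eq_none S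
  -- A path with `l + 1` arrows makes only `l` rotations.
  refine ⟨N + 1, fun p hp h => ?_⟩
  cases p with
  | nil => simp at hp
  | cons p e =>
    obtain ⟨s, hs⟩ := iterate_rotate_of_avoidsRelations h
    rw [Quiver.Path.length_cons, Nat.add_le_add_iff_right] at hp
    rw [← Nat.sub_add_cancel hp, Function.iterate_add_apply, hN,
      Function.iterate_fixed rfl] at hs
    cases hs

variable (S k) in
/-- The span of the paths of length at least `n`. -/
def pathsOfLengthGE (n : ℕ) : Submodule k (PathAlgebra k S.Arc) :=
  Submodule.span k {x | ∃ (a b : S.Arc) (p : Quiver.Path a b), n ≤ p.length ∧ x = ofPath k p}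

theorem mul_mem_pathsOfLengthGE {m n : ℕ} {x y : PathAlgebra k S.Arc}
    (hx : x ∈ pathsOfLengthGE S k m) (hy : y ∈ pathsOfLengthGE S k n) :
    x * y ∈ pathsOfLengthGE S k (m + n) := by
  induction hx using Submodule.span_induction with
  | zero => rw [zero_mul']; exact zero_mem _
  | add y z _ _ hy hz => rw [add_mul']; exact add_mem hy hz
  | smul c y _ hy => rw [PathAlgebra.smul_mul']; exact Submodule.smul_mem _ c hy
  | mem x hx =>
    obtain ⟨a, b, p, hp, rfl⟩ := hx
    induction hy using Submodule.span_induction with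
    | zero => rw [mul_zero']; exact zero_mem _
    | add y z _ _ hy hz => rw [mul_add']; exact add_mem hy hz
    | smul c y _ hy => rw [mul_smul']; exact Submodule.smul_mem _ c hy
    | mem y hy =>
      obtain ⟨c, d, q, hq, rfl⟩ := hy
      by_cases h : c = b
      · subst h
        rw [ofPath_mul_ofPath]
        exact Submodule.subset_span ⟨_, _, _, by rw [Quiver.Path.length_comp]; omega, rfl⟩
      · rw [ofPath_mul_ofPath_of_ne _ _ h]
        exact zero_mem _

theorem mem_pathsOfLengthGE_zero (x : PathAlgebra k S.Arc) : x ∈ pathsOfLengthGE S k 0 :=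
  mem_of_forall_coeff fun p _ => Submodule.subset_span ⟨_, _, p, Nat.zero_le _, rfl⟩

variable (S k) in
/-- The right ideal of the gentle algebra given by the paths of length at least `n`. -/
def lengthIdeal (n : ℕ) : Ideal (S.GentleAlgebra k)ᵐᵒᵖ where
  carrier := {r | ∃ x ∈ pathsOfLengthGE S k n, r = MulOpposite.op (toGentle S k x)}
  zero_mem' := ⟨0, zero_mem _, by rw [map_zero]; rfl⟩
  add_mem' := by
    rintro _ _ ⟨x, hx, rfl⟩ ⟨y, hy, rfl⟩
    exact ⟨x + y, add_mem hx hy, by rw [map_add]; rfl⟩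
  smul_mem' := by
    rintro r z ⟨x, hx, hz⟩
    obtain ⟨y, hy⟩ := toGentle_surjective r.unop
    have h1 := mul_mem_pathsOfLengthGE hx (mem_pathsOfLengthGE_zero y)
    rw [add_zero] at h1
    refine ⟨x * y, h1, ?_⟩
    rw [map_mul, hy, MulOpposite.op_mul, MulOpposite.op_unop, ← hz]
    exact smul_eq_mul _ _

theorem lengthIdeal_zero : lengthIdeal S k 0 = ⊤ := by
  refine top_le_iff.1 fun r _ => ?_
  obtain ⟨y, hy⟩ := toGentle_surjective r.unop
  exact ⟨y, mem_pathsOfLengthGE_zero y, by rw [hy]; rfl⟩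

theorem mul_mem_lengthIdeal (n : ℕ) (r : (S.GentleAlgebra k)ᵐᵒᵖ) (hr : r ∈ lengthIdeal S k 1)
    (r' : (S.GentleAlgebra k)ᵐᵒᵖ) (hr' : r' ∈ lengthIdeal S k n) :
    r * r' ∈ lengthIdeal S k (n + 1) := by
  obtain ⟨x, hx, rfl⟩ := hr
  obtain ⟨y, hy, rfl⟩ := hr'
  exact ⟨y * x, mul_mem_pathsOfLengthGE hy hx, by rw [map_mul]; rfl⟩

variable (S k) in
theorem exists_lengthIdeal_eq_bot : ∃ n, lengthIdeal S k n = ⊥ := by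
  obtain ⟨N, hN⟩ := exists_not_avoidsRelations S
  refine ⟨N, le_bot_iff.1 ?_⟩
  rintro _ ⟨x, hx, rfl⟩
  have : pathsOfLengthGE S k N ≤ relationSubmodule S k := by
    refine Submodule.span_le.2 ?_
    rintro _ ⟨a, b, p, hp, rfl⟩
    exact ofPath_mem_relationIdeal (hN p hp)
  rw [Submodule.mem_bot, toGentle_eq_zero_iff.2 (this hx), MulOpposite.op_zero]

theorem op_arrowElem_mem (s : S.OrientedArc) :
    MulOpposite.op (arrowElem k s) ∈ lengthIdeal S k 1 := by
  refine ⟨arrowPath k s, ?_, rfl⟩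
  rcases hs : S.next s with _ | t
  · rw [arrowPath_of_none k hs]
    exact zero_mem _
  · rw [arrowPath_of_some k hs]
    exact Submodule.subset_span ⟨_, _, _, by simp, rfl⟩

/-- Long paths vanish, and the short ones are finitely many, since a path is determined by its
starting vertex and its list of sides. -/
instance : Module.Finite k (S.GentleAlgebra k) := by
  obtain ⟨N, hN⟩ := exists_not_avoidsRelations S
  let P := {p : Σ a b : S.Arc, Quiver.Path a b // p.2.2.length ≤ N}
  let L := {l : List S.OrientedArc // l.length ≤ N}
  have : Finite L := (List.finite_length_le _ N).to_subtype
  let f : P → S.Arc × L := fun p => (p.1.1, ⟨arrows p.1.2.2, by simpa using p.2⟩)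
  have hf : Function.Injective f := by
    rintro ⟨⟨a, b, p⟩, hp⟩ ⟨⟨a', b', q⟩, hq⟩ h
    simp only [f, Prod.mk.injEq] at h
    obtain ⟨rfl, h⟩ := h
    cases arrows_injective (congrArg Subtype.val h)
    rfl
  have : Finite P := Finite.of_injective f hf
  refine ⟨⟨(Set.finite_range fun p : P => toGentle S k (ofPath k p.1.2.2)).toFinset, ?_⟩⟩
  rw [Set.Finite.coe_toFinset]
  refine top_le_iff.1 fun x _ => ?_
  obtain ⟨x, rfl⟩ := toGentle_surjective x
  induction x using induction with
  | zero => rw [map_zero]; exact zero_mem _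
  | add x y hx hy => rw [map_add]; exact add_mem (hx trivial) (hy trivial)
  | @smul c a b p =>
    rw [toGentle_smul]
    refine Submodule.smul_mem _ c ?_
    by_cases hp : p.length ≤ N
    · exact Submodule.subset_span ⟨⟨⟨a, b, p⟩, hp⟩, rfl⟩
    · rw [toGentle_eq_zero_iff.2 (ofPath_mem_relationIdeal (hN p (by omega)))]
      exact zero_mem _

instance : IsArtinianRing (S.GentleAlgebra k)ᵐᵒᵖ := IsArtinianRing.of_finite k _

end MarkedRibbonSurface

namespace MarkedRibbonSurface

variable {S : MarkedRibbonSurface} {k : Type u} [Field k]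

/-! ### Iterating the successor of a side -/

/-- The `i`-th successor of a side of an elementary polygon. -/
def nextIter (i : ℕ) (s : S.OrientedArc) : Option S.OrientedArc :=
  (fun o => o.bind S.next)^[i] (some s)

theorem nextIter_succ (i : ℕ) (s : S.OrientedArc) :
    nextIter (i + 1) s = (nextIter i s).bind S.next :=
  Function.iterate_succ_apply' _ _ _

theorem nextIter_succ_of_some {s t : S.OrientedArc} (h : S.next s = some t) (i : ℕ) :
    nextIter (i + 1) s = nextIter i t := by
  rw [nextIter, Function.iterate_succ_apply, Option.bind_some, h]
  rfl

theorem nextIter_succ_of_none {s : S.OrientedArc} (h : S.next s = none) (i : ℕ) :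
    nextIter (i + 1) s = none := by
  rw [nextIter, Function.iterate_succ_apply, Option.bind_some, h]
  exact Function.iterate_fixed rfl i

/-! ### Projective, simple and uniserial modules -/

variable (k) in
/-- The right ideal generated by an arrow. -/
def arrowModule (s : S.OrientedArc) :
    Submodule (S.GentleAlgebra k)ᵐᵒᵖ (S.GentleAlgebra k) :=
  Submodule.span _ {arrowElem k s}

theorem mem_arrowModule_iff {s : S.OrientedArc} {x : S.GentleAlgebra k} :
    x ∈ arrowModule k s ↔ ∃ y, arrowElem k s * y = x := by
  rw [arrowModule, Submodule.mem_span_singleton]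
  exact ⟨fun ⟨r, hr⟩ => ⟨r.unop, hr⟩, fun ⟨y, hy⟩ => ⟨MulOpposite.op y, hy⟩⟩

theorem mem_proj_iff {v : S.Arc} {x : S.GentleAlgebra k} :
    x ∈ S.proj k v ↔ S.idem k v * x = x := by
  rw [proj, Submodule.mem_span_singleton]
  constructor
  · rintro ⟨r, rfl⟩
    change S.idem k v * (S.idem k v * r.unop) = S.idem k v * r.unop
    rw [← mul_assoc, idem_mul_idem]
  · exact fun h => ⟨MulOpposite.op x, h⟩

theorem idem_mem_proj (v : S.Arc) : S.idem k v ∈ S.proj k v := mem_proj_iff.2 (idem_mul_idem v)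

theorem arrowElem_mul_mem_proj {s : S.OrientedArc} {v : S.Arc} (h : S.arc s = v)
    (y : S.GentleAlgebra k) : arrowElem k s * y ∈ S.proj k v := by
  subst h
  rw [mem_proj_iff, ← mul_assoc, idem_mul_arrowElem]

theorem arrowModule_le_proj {s : S.OrientedArc} {v : S.Arc} (h : S.arc s = v) :
    arrowModule k s ≤ S.proj k v := by
  intro x hx
  obtain ⟨y, rfl⟩ := mem_arrowModule_iff.1 hx
  exact arrowElem_mul_mem_proj h y

theorem arrowModule_of_none {s : S.OrientedArc} (h : S.next s = none) :
    arrowModule k s = ⊥ := by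
  rw [arrowModule, arrowElem_of_none h, Submodule.span_zero_singleton]

/-- Left multiplication by an element, as an endomorphism of the right regular module. -/
def leftMul (a : S.GentleAlgebra k) :
    S.GentleAlgebra k →ₗ[(S.GentleAlgebra k)ᵐᵒᵖ] S.GentleAlgebra k where
  toFun x := a * x
  map_add' := mul_add a
  map_smul' r x := (mul_assoc a x r.unop).symm

@[simp]
theorem leftMul_apply (a x : S.GentleAlgebra k) : leftMul a x = a * x := rfl

instance : Module.Projective (S.GentleAlgebra k)ᵐᵒᵖ (S.GentleAlgebra k) := by
  let e : (S.GentleAlgebra k)ᵐᵒᵖ ≃ₗ[(S.GentleAlgebra k)ᵐᵒᵖ] S.GentleAlgebra k :=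
    { MulOpposite.opAddEquiv.symm with
      map_smul' := fun _ _ => rfl }
  exact Module.Projective.of_equiv e

instance (v : S.Arc) : Module.Projective (S.GentleAlgebra k)ᵐᵒᵖ (S.proj k v) := by
  refine Module.Projective.of_split (S.proj k v).subtype
    ((leftMul (S.idem k v)).codRestrict (S.proj k v) fun x => mem_proj_iff.2 ?_) ?_
  · rw [leftMul_apply, ← mul_assoc, idem_mul_idem]
  · ext x
    exact mem_proj_iff.1 x.2

variable (S k) in
/-- The character of a vertex, as a map from the regular module onto the simple module. -/
def toSimple (v : S.Arc) : S.GentleAlgebra k →ₗ[(S.GentleAlgebra k)ᵐᵒᵖ] S.Simple k v where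
  toFun := S.character k v
  map_add' := map_add _
  map_smul' r x := map_mul (S.character k v) x r.unop

theorem smul_simple (v : S.Arc) (r : (S.GentleAlgebra k)ᵐᵒᵖ) (c : S.Simple k v) :
    r • c = (show k from c) * S.character k v r.unop := rfl

theorem smul_simple_eq_zero {v : S.Arc} {r : (S.GentleAlgebra k)ᵐᵒᵖ}
    (h : S.character k v r.unop = 0) (c : S.Simple k v) : r • c = 0 := by
  rw [smul_simple, h]
  exact mul_zero (M₀ := k) _

theorem toSimple_proj_surjective (v : S.Arc) :
    Function.Surjective ((toSimple S k v).domRestrict (S.proj k v)) := by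
  intro c
  refine ⟨⟨(show k from c) • S.idem k v, ?_⟩, ?_⟩
  · rw [mem_proj_iff, mul_smul_comm, idem_mul_idem]
  · change S.character k v ((show k from c) • S.idem k v) = c
    rw [character_smul, character_idem_self]
    exact mul_one (M := k) _

instance (v : S.Arc) : Nontrivial (S.Simple k v) := inferInstanceAs (Nontrivial k)

instance (v : S.Arc) : IsSimpleModule (S.GentleAlgebra k)ᵐᵒᵖ (S.Simple k v) := by
  refine isSimpleModule_iff_toSpanSingleton_surjective.2 ⟨inferInstance, fun c hc d => ?_⟩
  refine ⟨MulOpposite.op (((show k from c)⁻¹ * (show k from d)) • S.idem k v), ?_⟩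
  rw [LinearMap.toSpanSingleton_apply, smul_simple, MulOpposite.unop_op, character_smul,
    character_idem_self, mul_one]
  exact mul_inv_cancel_left₀ (G₀ := k) hc _

/-- Since `x = e_v x`, the value `f x` is `f e_v` acted on by `x`, and `x` acts on the simple module
through its character. Maps from projectives to simples therefore kill radicals, as dimension
shifting requires. -/
theorem map_proj_eq_zero {v w : S.Arc}
    (f : S.proj k v →ₗ[(S.GentleAlgebra k)ᵐᵒᵖ] S.Simple k w) (x : S.proj k v)
    (hx : S.character k w x = 0) : f x = 0 := by
  have h1 : x = MulOpposite.op (x : S.GentleAlgebra k) • (⟨_, idem_mem_proj v⟩ : S.proj k v) :=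
    Subtype.ext (mem_proj_iff.1 x.2).symm
  rw [h1, map_smul, smul_simple_eq_zero hx]

theorem character_eq_zero_of_mem_arrowModule {s : S.OrientedArc} {x : S.GentleAlgebra k}
    (hx : x ∈ arrowModule k s) (v : S.Arc) : S.character k v x = 0 := by
  obtain ⟨y, rfl⟩ := mem_arrowModule_iff.1 hx
  rw [map_mul, character_arrowElem, zero_mul]

/-! ### The first syzygies -/

variable (k) in
/-- Left multiplication by an arrow, from the projective module at its end onto the right ideal
generated by it. -/
def arrowCover (s : S.OrientedArc) (v : S.Arc) :
    S.proj k v →ₗ[(S.GentleAlgebra k)ᵐᵒᵖ] arrowModule k s :=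
  (leftMul (arrowElem k s)).restrict fun x _ => mem_arrowModule_iff.2 ⟨x, rfl⟩

theorem arrowCover_surjective {s t : S.OrientedArc} (h : S.next s = some t) :
    Function.Surjective (arrowCover k s (S.arc t)) := by
  rintro ⟨x, hx⟩
  obtain ⟨y, rfl⟩ := mem_arrowModule_iff.1 hx
  refine ⟨⟨S.idem k (S.arc t) * y, ?_⟩, Subtype.ext ?_⟩
  · rw [mem_proj_iff, ← mul_assoc, idem_mul_idem]
  · change arrowElem k s * (S.idem k (S.arc t) * y) = arrowElem k s * y
    rw [← mul_assoc, arrowElem_mul_idem h]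

theorem exact_arrowCover {s t : S.OrientedArc} (h : S.next s = some t) :
    Function.Exact (Submodule.inclusion (arrowModule_le_proj (k := k) (s := t) rfl))
      (arrowCover k s (S.arc t)) := by
  intro x
  rw [← Subtype.val_inj]
  change arrowElem k s * x = 0 ↔ _
  constructor
  · intro hx
    obtain ⟨y, hy⟩ := exists_eq_arrowElem_mul h (mem_proj_iff.1 x.2) hx
    exact ⟨⟨x, mem_arrowModule_iff.2 ⟨y, hy.symm⟩⟩, rfl⟩
  · rintro ⟨⟨z, hz⟩, rfl⟩
    obtain ⟨y, rfl⟩ := mem_arrowModule_iff.1 hz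
    change arrowElem k s * (arrowElem k t * y) = 0
    rw [← mul_assoc, arrowElem_mul_arrowElem h, zero_mul]

variable (k) in
/-- The inclusion of the radical of a projective module. -/
def radInclusion (s : S.OrientedArc) :
    (arrowModule k s × arrowModule k (S.opp s)) →ₗ[(S.GentleAlgebra k)ᵐᵒᵖ] S.proj k (S.arc s) :=
  (Submodule.inclusion (arrowModule_le_proj rfl)).coprod
    (Submodule.inclusion (arrowModule_le_proj (arc_opp s)))

theorem character_radInclusion (s : S.OrientedArc) (w : S.Arc)
    (x : arrowModule k s × arrowModule k (S.opp s)) :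
    S.character k w (radInclusion k s x) = 0 := by
  change S.character k w (x.1 + x.2) = 0
  rw [map_add, character_eq_zero_of_mem_arrowModule x.1.2,
    character_eq_zero_of_mem_arrowModule x.2.2, add_zero]

theorem radInclusion_injective (s : S.OrientedArc) : Function.Injective (radInclusion k s) := by
  rw [← LinearMap.ker_eq_bot, LinearMap.ker_eq_bot']
  rintro ⟨⟨x, hx⟩, ⟨y, hy⟩⟩ h
  obtain ⟨x, rfl⟩ := mem_arrowModule_iff.1 hx
  obtain ⟨y, rfl⟩ := mem_arrowModule_iff.1 hy
  have h1 : arrowElem k s * x + arrowElem k (S.opp s) * y = 0 := congrArg Subtype.val h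
  have h2 := arrowElem_mul_eq_zero_of_add (S.opp_ne s).symm h1
  rw [h2, zero_add] at h1
  exact Prod.ext (Subtype.ext h2) (Subtype.ext h1)

theorem exact_radInclusion (s : S.OrientedArc) :
    Function.Exact (radInclusion k s)
      ((toSimple S k (S.arc s)).domRestrict (S.proj k (S.arc s))) := by
  intro x
  constructor
  · intro hx
    obtain ⟨y, z, h⟩ := exists_eq_of_character_eq_zero (mem_proj_iff.1 x.2) hx
    exact ⟨⟨⟨_, mem_arrowModule_iff.2 ⟨y, rfl⟩⟩, ⟨_, mem_arrowModule_iff.2 ⟨z, rfl⟩⟩⟩,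
      Subtype.ext h.symm⟩
  · rintro ⟨y, rfl⟩
    exact character_radInclusion s _ y

variable (k) in
/-- The short exact sequence `0 → βA → e A → αA → 0` of two arrows `α`, `β` at consecutive corners
of an elementary polygon. -/
abbrev arrowShortComplex {s t : S.OrientedArc} (h : S.next s = some t) :
    ShortComplex (ModuleCat.{u} (S.GentleAlgebra k)ᵐᵒᵖ) :=
  ModuleCat.shortComplexOfCompEqZero
    (Submodule.inclusion (arrowModule_le_proj (k := k) (s := t) rfl)) (arrowCover k s (S.arc t))
    (exact_arrowCover h).linearMap_comp_eq_zero

theorem arrowShortComplex_shortExact {s t : S.OrientedArc} (h : S.next s = some t) :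
    (arrowShortComplex k h).ShortExact :=
  ModuleCat.shortComplex_shortExact _ (exact_arrowCover h)
    (Submodule.inclusion_injective (arrowModule_le_proj rfl))
    (arrowCover_surjective h)

variable (k) in
/-- The short exact sequence of the radical of a projective module. -/
abbrev radShortComplex (s : S.OrientedArc) :
    ShortComplex (ModuleCat.{u} (S.GentleAlgebra k)ᵐᵒᵖ) :=
  ModuleCat.shortComplexOfCompEqZero (radInclusion k s)
    ((toSimple S k (S.arc s)).domRestrict (S.proj k (S.arc s)))
    (exact_radInclusion s).linearMap_comp_eq_zero

theorem radShortComplex_shortExact (s : S.OrientedArc) : (radShortComplex k s).ShortExact :=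
  ModuleCat.shortComplex_shortExact _ (exact_radInclusion s) (radInclusion_injective s)
    (toSimple_proj_surjective _)

/-! ### Extensions between simple modules -/

/-- The module generated by an arrow is cyclic, with top the simple module at the end of the arrow.
-/
theorem subsingleton_hom_arrowModule_iff (s : S.OrientedArc) (w : S.Arc) :
    Subsingleton (Ext (ModuleCat.of (S.GentleAlgebra k)ᵐᵒᵖ (arrowModule k s))
      (ModuleCat.of _ (S.Simple k w)) 0) ↔ ∀ t, S.next s = some t → S.arc t ≠ w := by
  rw [subsingleton_ext_zero_iff]
  constructor
  · rintro h t ht rfl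
    have hT := arrowShortComplex_shortExact (k := k) ht
    have := hT.epi_g
    -- The character vanishes on the kernel of the cover, so it descends to a nonzero map on the
    -- right ideal of the arrow.
    let f := hT.exact.desc (ModuleCat.ofHom ((toSimple S k (S.arc t)).domRestrict _)) (by
      ext x
      exact character_eq_zero_of_mem_arrowModule x.2 _)
    have hf : (arrowShortComplex k ht).g ≫ f = _ := hT.exact.g_desc _ _
    rw [h f, Limits.comp_zero] at hf
    have h1 := congrArg (fun φ => φ.hom ⟨_, idem_mem_proj (S.arc t)⟩) hf
    have h2 : (0 : k) = S.character k (S.arc t) (S.idem k (S.arc t)) := h1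
    rw [character_idem_self] at h2
    exact zero_ne_one h2
  · intro h f
    ext x
    obtain ⟨y, hy⟩ := mem_arrowModule_iff.1 x.2
    rcases hs : S.next s with _ | t
    · have : x = 0 := Subtype.ext (by rw [← hy, arrowElem_of_none hs, zero_mul]; rfl)
      rw [this, map_zero, map_zero]
    · have h1 : x = MulOpposite.op (S.idem k (S.arc t) * y) •
          (⟨_, Submodule.mem_span_singleton_self _⟩ : arrowModule k s) := Subtype.ext (by
        change (x : S.GentleAlgebra k) = arrowElem k s * (S.idem k (S.arc t) * y)
        rw [← mul_assoc, arrowElem_mul_idem hs, hy])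
      rw [h1, map_smul]
      refine smul_simple_eq_zero ?_ _
      rw [MulOpposite.unop_op, map_mul, character_idem_of_ne (h t hs), zero_mul]

/-- Each dimension shift replaces the right ideal of an arrow by that of the next arrow around the
polygon. When there is no next side, the module is zero and the condition is empty. -/
theorem subsingleton_ext_arrowModule_iff (s : S.OrientedArc) (w : S.Arc) (i : ℕ) :
    Subsingleton (Ext (ModuleCat.of (S.GentleAlgebra k)ᵐᵒᵖ (arrowModule k s))
      (ModuleCat.of _ (S.Simple k w)) i) ↔ ∀ r, nextIter (i + 1) s = some r → S.arc r ≠ w := by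
  induction i generalizing s with
  | zero => exact subsingleton_hom_arrowModule_iff s w
  | succ i ih =>
    rcases hs : S.next s with _ | t
    · refine ⟨fun _ r hr => (by rw [nextIter_succ_of_none hs] at hr; cases hr), fun _ => ?_⟩
      have : Subsingleton (arrowModule k s) := by
        rw [arrowModule_of_none hs]
        infer_instance
      refine subsingleton_of_forall_eq 0 fun x => ?_
      rw [← x.mk₀_id_comp, (ModuleCat.isZero_of_subsingleton _).eq_of_src (𝟙 _) 0, Ext.mk₀_zero,
        Ext.zero_comp]
    · rw [nextIter_succ_of_some hs, ← ih t]
      refine subsingleton_ext_succ_iff (arrowShortComplex_shortExact (k := k) hs) (fun f => ?_) i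
      ext x
      exact map_proj_eq_zero f.hom _ (character_eq_zero_of_mem_arrowModule x.2 w)

theorem subsingleton_ext_prod_iff {R : Type u} [Ring R] {M N : Type u} [AddCommGroup M]
    [Module R M] [AddCommGroup N] [Module R N] (X : ModuleCat.{u} R) (i : ℕ) :
    Subsingleton (Ext (ModuleCat.of R (M × N)) X i) ↔
      Subsingleton (Ext (ModuleCat.of R M) X i) ∧ Subsingleton (Ext (ModuleCat.of R N) X i) := by
  constructor
  · intro h
    let r₁ : Retract (ModuleCat.of R M) (ModuleCat.of R (M × N)) :=
      { i := ModuleCat.ofHom (LinearMap.inl R M N)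
        r := ModuleCat.ofHom (LinearMap.fst R M N)
        retract := rfl }
    let r₂ : Retract (ModuleCat.of R N) (ModuleCat.of R (M × N)) :=
      { i := ModuleCat.ofHom (LinearMap.inr R M N)
        r := ModuleCat.ofHom (LinearMap.snd R M N)
        retract := rfl }
    exact ⟨subsingleton_ext_of_retract r₁ h, subsingleton_ext_of_retract r₂ h⟩
  · rintro ⟨h₁, h₂⟩
    exact subsingleton_ext_of_shortExact (ModuleCat.shortComplex_shortExact
      (ModuleCat.shortComplexOfCompEqZero (LinearMap.inl R M N) (LinearMap.snd R M N) rfl)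
      Function.Exact.inl_snd LinearMap.inl_injective LinearMap.snd_surjective) h₁ h₂

/-- The radical of the projective cover is the direct sum of two arrow modules, one for each side of
the arc. Both homological dimensions are read off from this formula. -/
theorem subsingleton_ext_simple_iff (s : S.OrientedArc) (w : S.Arc) (i : ℕ) :
    Subsingleton (Ext (ModuleCat.of (S.GentleAlgebra k)ᵐᵒᵖ (S.Simple k (S.arc s)))
      (ModuleCat.of _ (S.Simple k w)) (i + 1)) ↔
      (∀ r, nextIter (i + 1) s = some r → S.arc r ≠ w) ∧
        ∀ r, nextIter (i + 1) (S.opp s) = some r → S.arc r ≠ w := by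
  rw [← subsingleton_ext_arrowModule_iff (k := k), ← subsingleton_ext_arrowModule_iff (k := k),
    ← subsingleton_ext_prod_iff]
  refine subsingleton_ext_succ_iff (radShortComplex_shortExact (k := k) s) (fun f => ?_) i
  exact ModuleCat.hom_ext (LinearMap.ext fun x =>
    map_proj_eq_zero f.hom _ (character_radInclusion s w x))

end MarkedRibbonSurface

namespace MarkedRibbonSurface

variable {S : MarkedRibbonSurface} {k : Type u} [Field k]

/-! ### The simple modules -/

theorem isSuperfluous_of_le_lengthIdeal {M : Type u} [AddCommGroup M]
    [Module (S.GentleAlgebra k)ᵐᵒᵖ M] {N : Submodule (S.GentleAlgebra k)ᵐᵒᵖ M}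
    (h : N ≤ lengthIdeal S k 1 • ⊤) : IsSuperfluous N := by
  obtain ⟨n, hn⟩ := exists_lengthIdeal_eq_bot S k
  exact isSuperfluous_of_le_smul_top lengthIdeal_zero hn mul_mem_lengthIdeal h

theorem op_arrowElem_mul_mem (s : S.OrientedArc) (y : S.GentleAlgebra k) :
    MulOpposite.op (arrowElem k s * y) ∈ lengthIdeal S k 1 := by
  rw [MulOpposite.op_mul]
  exact Ideal.mul_mem_left _ _ (op_arrowElem_mem s)

/-- By Nakayama the arrow ideal annihilates `T`, and some `e_v` moves a vector `t`. The map `x ↦ t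
x` on `e_v A` then factors through the simple module at `v`, and Schur's lemma makes the induced map
an isomorphism. -/
theorem exists_linearEquiv_simple (T : Type u) [AddCommGroup T]
    [Module (S.GentleAlgebra k)ᵐᵒᵖ T] [IsSimpleModule (S.GentleAlgebra k)ᵐᵒᵖ T] :
    ∃ v : S.Arc, Nonempty (S.Simple k v ≃ₗ[(S.GentleAlgebra k)ᵐᵒᵖ] T) := by
  have hT := IsSimpleModule.nontrivial (S.GentleAlgebra k)ᵐᵒᵖ T
  have hrad : ∀ r ∈ lengthIdeal S k 1, ∀ t : T, r • t = 0 := by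
    intro r hr t
    have h1 : r • t ∈ lengthIdeal S k 1 • (⊤ : Submodule (S.GentleAlgebra k)ᵐᵒᵖ T) :=
      Submodule.smul_mem_smul hr trivial
    rcases eq_bot_or_eq_top (lengthIdeal S k 1 • (⊤ : Submodule (S.GentleAlgebra k)ᵐᵒᵖ T))
      with h | h
    · rwa [h, Submodule.mem_bot] at h1
    · exact absurd (isSuperfluous_of_le_lengthIdeal (S := S) (k := k) le_rfl ⊥
        (by rw [h, top_sup_eq])) bot_ne_top
  obtain ⟨t, ht⟩ := exists_ne (0 : T)
  obtain ⟨v, hv⟩ : ∃ v : S.Arc, MulOpposite.op (S.idem k v) • t ≠ 0 := by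
    by_contra! h
    refine ht ?_
    rw [← one_smul (S.GentleAlgebra k)ᵐᵒᵖ t, ← MulOpposite.op_one, ← sum_idem,
      Finset.op_sum, Finset.sum_smul]
    exact Finset.sum_eq_zero fun v _ => h v
  obtain ⟨s, rfl⟩ := exists_arc_eq v
  let f : S.proj k (S.arc s) →ₗ[(S.GentleAlgebra k)ᵐᵒᵖ] T :=
    { toFun := fun x => MulOpposite.op (x : S.GentleAlgebra k) • t
      map_add' := fun x y => by
        rw [← add_smul]
        rfl
      map_smul' := fun r x => by
        rw [RingHom.id_apply, smul_smul]
        rfl }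
  have hf : LinearMap.ker ((toSimple S k (S.arc s)).domRestrict (S.proj k (S.arc s))) ≤
      LinearMap.ker f := by
    intro x hx
    obtain ⟨y, z, h⟩ := exists_eq_of_character_eq_zero (mem_proj_iff.1 x.2) hx
    refine hrad _ ?_ t
    rw [h, MulOpposite.op_add]
    exact add_mem (op_arrowElem_mul_mem _ _) (op_arrowElem_mul_mem _ _)
  let e := LinearMap.quotKerEquivOfSurjective _ (toSimple_proj_surjective (k := k) (S.arc s))
  let g := ((LinearMap.ker _).liftQ f hf).comp e.symm.toLinearMap
  have hg : g ≠ 0 := by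
    intro h
    refine hv ?_
    have h1 : f ⟨_, idem_mem_proj _⟩ = g (e (Submodule.Quotient.mk ⟨_, idem_mem_proj _⟩)) := by
      rw [LinearMap.comp_apply, LinearEquiv.coe_coe, LinearEquiv.symm_apply_apply,
        Submodule.liftQ_apply]
    rw [h] at h1
    exact h1
  exact ⟨S.arc s, ⟨LinearEquiv.ofBijective g (LinearMap.bijective_of_ne_zero hg)⟩⟩

/-! ### Homological dimensions -/

theorem not_isZero_simple (v : S.Arc) :
    ¬ Limits.IsZero (ModuleCat.of (S.GentleAlgebra k)ᵐᵒᵖ (S.Simple k v)) := by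
  intro h
  rw [ModuleCat.isZero_iff_subsingleton] at h
  exact not_subsingleton (S.Simple k v) h

theorem hasInjectiveDimensionLT_simple {w : S.Arc} {n : ℕ}
    (h : ∀ s r, nextIter (n + 1) s = some r → S.arc r ≠ w) :
    HasInjectiveDimensionLT (ModuleCat.of (S.GentleAlgebra k)ᵐᵒᵖ (S.Simple k w)) (n + 1) := by
  refine hasInjectiveDimensionLT_of_simple n _ fun T _ _ _ => ?_
  obtain ⟨v, ⟨e⟩⟩ := exists_linearEquiv_simple (S := S) (k := k) T
  obtain ⟨s, rfl⟩ := exists_arc_eq v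
  exact subsingleton_ext_of_retract e.toModuleIso.symm.retract
    ((subsingleton_ext_simple_iff s w n).2 ⟨h s, h (S.opp s)⟩)

/-- The injective dimension is the length of the longest chain of successors that ends at a side of
`w`. -/
theorem injectiveDimension_simple {w : S.Arc} {n : ℕ}
    (h : ∀ s r, nextIter (n + 1) s = some r → S.arc r ≠ w)
    {s r : S.OrientedArc} (hs : nextIter n s = some r) (hr : S.arc r = w) :
    injectiveDimension (ModuleCat.of (S.GentleAlgebra k)ᵐᵒᵖ (S.Simple k w)) = n := by
  refine le_antisymm ?_ ?_
  · exact (injectiveDimension_le_iff _ n).2 (hasInjectiveDimensionLT_simple h)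
  · rw [injectiveDimension_ge_iff]
    intro hn
    -- The formula for Ext covers positive degrees only; for `n = 0` it is enough that the simple
    -- module is nonzero.
    rcases n with _ | n
    · exact not_isZero_simple w ((hasInjectiveDimensionLT_zero_iff_isZero _).1 hn)
    · exact ((subsingleton_ext_simple_iff (k := k) s w n).1 (hn.subsingleton _ _ _ le_rfl _)).1
        r hs hr

/-- The projectives resolving the arrow module sit at the successors `1, …, n`. For `n = 0` there is
no arrow at all and the module is zero. -/
theorem hasProjectiveDimensionLT_arrowModule {s : S.OrientedArc} {n : ℕ}
    (h : nextIter (n + 1) s = none) :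
    HasProjectiveDimensionLT (ModuleCat.of (S.GentleAlgebra k)ᵐᵒᵖ (arrowModule k s)) n := by
  induction n generalizing s with
  | zero =>
    have : Subsingleton (arrowModule k s) := by
      rw [arrowModule_of_none h]
      infer_instance
    exact (ModuleCat.isZero_of_subsingleton _).hasProjectiveDimensionLT_zero
  | succ n ih =>
    rcases hs : S.next s with _ | t
    · have : Subsingleton (arrowModule k s) := by
        rw [arrowModule_of_none hs]
        infer_instance
      have := (ModuleCat.isZero_of_subsingleton (ModuleCat.of (S.GentleAlgebra k)ᵐᵒᵖ
        (arrowModule k s))).hasProjectiveDimensionLT_zero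
      exact hasProjectiveDimensionLT_of_ge _ 0 _ (Nat.zero_le _)
    · rw [nextIter_succ_of_some hs] at h
      exact (arrowShortComplex_shortExact (k := k) hs).hasProjectiveDimensionLT_X₃ n (ih h)
        inferInstance

/-- The upper bound comes from the radical sequence; the lower bound from a nonzero Ext into the
simple module at the end of a longest chain. -/
theorem projectiveDimension_simple {s : S.OrientedArc} {n : ℕ}
    (h₁ : nextIter (n + 1) s = none) (h₂ : nextIter (n + 1) (S.opp s) = none)
    (hn : nextIter n s ≠ none ∨ nextIter n (S.opp s) ≠ none) :
    projectiveDimension (ModuleCat.of (S.GentleAlgebra k)ᵐᵒᵖ (S.Simple k (S.arc s))) = n := by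
  refine le_antisymm ?_ ?_
  · refine (projectiveDimension_le_iff _ n).2 ?_
    have hT := radShortComplex_shortExact (k := k) s
    refine hT.hasProjectiveDimensionLT_X₃ n ?_ inferInstance
    exact (ModuleCat.shortComplex_shortExact
      (ModuleCat.shortComplexOfCompEqZero (LinearMap.inl _ _ _) (LinearMap.snd _ _ _) rfl)
      Function.Exact.inl_snd LinearMap.inl_injective
      LinearMap.snd_surjective).hasProjectiveDimensionLT_X₂ n
        (hasProjectiveDimensionLT_arrowModule h₁) (hasProjectiveDimensionLT_arrowModule h₂)
  · rw [projectiveDimension_ge_iff]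
    intro hd
    rcases n with _ | n
    · exact not_isZero_simple _ ((hasProjectiveDimensionLT_zero_iff_isZero _).1 hd)
    · have h := fun w => (subsingleton_ext_simple_iff (k := k) s w n).1
        (hd.subsingleton _ _ _ le_rfl _)
      rcases hn with hn | hn
      · obtain ⟨r, hr⟩ := Option.ne_none_iff_exists'.1 hn
        exact (h (S.arc r)).1 r hr rfl
      · obtain ⟨r, hr⟩ := Option.ne_none_iff_exists'.1 hn
        exact (h (S.arc r)).2 r hr rfl

end MarkedRibbonSurface

/-! ### Endpoints of consecutive sides. -/

namespace PolygonGluing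

variable {G : PolygonGluing}

theorem fst_eq_of_next {s t : G.OrientedArc} (h : G.next s = some t) : t.1 = s.1 := by
  unfold next at h
  split_ifs at h <;> cases h <;> rfl

theorem curve_one_eq_of_next {s t : G.OrientedArc} (h : G.next s = some t) :
    G.curve s 1 = G.curve t 0 := by
  refine congrArg (Quot.mk _) ?_
  unfold next at h
  split_ifs at h with h1 h2
  · cases h
    refine Sigma.ext rfl (heq_of_eq (Subtype.ext ?_))
    simp [sidePoint]
  · cases h
    refine Sigma.ext rfl (heq_of_eq (Subtype.ext ?_))
    -- This is the last side of an annulus: it ends at angle `-2π`, the same point as angle `0`,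
    -- where the first side starts.
    have h3 : s.2.val + 1 = G.numArcSides s.1 := le_antisymm s.2.2 (not_lt.1 h1)
    have h4 : ((s.2.val : ℝ) + 1) = G.numArcSides s.1 := by exact_mod_cast h3
    have h5 : (G.numArcSides s.1 : ℂ) ≠ 0 := by
      exact_mod_cast (G.numArcSides_pos s.1).ne'
    simp only [sidePoint, numOuterSides, h2, if_true, Set.Icc.coe_one, h4]
    push_cast
    rw [mul_div_assoc, div_self h5]
    simp [Complex.exp_neg, Complex.exp_two_pi_mul_I]

end PolygonGluing

namespace MarkedRibbonSurface

variable {S : MarkedRibbonSurface} {k : Type u} [Field k]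

/-! ### Chains -/

/-- A successor lies in the same polygon and starts where its predecessor ends, so the third
condition on a chain implies the other two. -/
theorem isCounterclockwiseChain_iff {n : ℕ} {γ : Fin (n + 1) → S.OrientedArc} :
    IsCounterclockwiseChain γ ↔ ∀ j : Fin n, S.next (γ j.castSucc) = some (γ j.succ) := by
  refine ⟨fun ⟨_, _, _, h⟩ j => (h j).2, fun h => ?_⟩
  have h1 : ∀ j, (γ j).1 = (γ 0).1 := by
    intro j
    induction j using Fin.induction with
    | zero => rfl
    | succ j ih => exact (PolygonGluing.fst_eq_of_next (h j)).trans ih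
  exact ⟨(γ 0).1, fun j => Or.inl (h1 j), fun j => PolygonGluing.curve_one_eq_of_next (h j),
    fun j => ⟨h1 _, h j⟩⟩

/-- Reversing the arcs and the order of the chain turns clockwise into counterclockwise, so `next`
governs this case as well. -/
theorem isClockwiseChain_iff {n : ℕ} {γ : Fin (n + 1) → S.OrientedArc} :
    IsClockwiseChain γ ↔
      ∀ j : Fin n, S.next (S.opp (γ j.succ)) = some (S.opp (γ j.castSucc)) := by
  refine ⟨fun ⟨_, _, _, h⟩ j => (h j).2, fun h => ?_⟩
  have h1 : ∀ j, (S.opp (γ j)).1 = (S.opp (γ 0)).1 := by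
    intro j
    induction j using Fin.induction with
    | zero => rfl
    | succ j ih => exact (PolygonGluing.fst_eq_of_next (h j)).symm.trans ih
  refine ⟨(S.opp (γ 0)).1, fun j => Or.inr (h1 j), fun j => ?_, fun j => ⟨h1 _, h j⟩⟩
  have h2 := PolygonGluing.curve_one_eq_of_next (h j)
  rw [PolygonGluing.curve_opp, PolygonGluing.curve_opp, unitInterval.symm_zero,
    unitInterval.symm_one] at h2
  exact h2.symm

theorem SatisfiesPD.next_last {n : ℕ} {γ : Fin (n + 1) → S.OrientedArc} (h : SatisfiesPD γ) :
    S.next (γ (Fin.last n)) = none := by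
  rw [Option.eq_none_iff_forall_ne_some]
  intro δ hδ
  refine h.2 δ (isCounterclockwiseChain_iff.2 fun j => ?_)
  induction j using Fin.lastCases with
  | last => rw [Fin.snoc_castSucc, Fin.succ_last, Fin.snoc_last, hδ]
  | cast j =>
    rw [Fin.snoc_castSucc, ← Fin.castSucc_succ, Fin.snoc_castSucc]
    exact isCounterclockwiseChain_iff.1 h.1 j

theorem SatisfiesID.next_ne {n : ℕ} {γ : Fin (n + 1) → S.OrientedArc} (h : SatisfiesID γ)
    (s : S.OrientedArc) : S.next s ≠ some (S.opp (γ (Fin.last n))) := by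
  intro hs
  refine h.2 (S.opp s) (isClockwiseChain_iff.2 fun j => ?_)
  induction j using Fin.lastCases with
  | last => rw [Fin.snoc_castSucc, Fin.succ_last, Fin.snoc_last, S.opp_opp, hs]
  | cast j =>
    rw [Fin.snoc_castSucc, ← Fin.castSucc_succ, Fin.snoc_castSucc]
    exact isClockwiseChain_iff.1 h.1 j

theorem SatisfiesPD.nextIter_eq {n : ℕ} {γ : Fin (n + 1) → S.OrientedArc} (h : SatisfiesPD γ)
    (j : Fin (n + 1)) : nextIter j (γ 0) = some (γ j) := by
  induction j using Fin.induction with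
  | zero => rfl
  | succ j ih =>
    rw [Fin.val_succ, nextIter_succ, ← Fin.val_castSucc, ih, Option.bind_some,
      isCounterclockwiseChain_iff.1 h.1 j]

theorem SatisfiesPD.nextIter_eq_none {n : ℕ} {γ : Fin (n + 1) → S.OrientedArc}
    (h : SatisfiesPD γ) {j : ℕ} (hj : n < j) : nextIter j (γ 0) = none := by
  induction j, hj using Nat.le_induction with
  | base =>
    have h1 := h.nextIter_eq (Fin.last n)
    rw [Fin.val_last] at h1
    rw [nextIter_succ, h1, Option.bind_some, h.next_last]
  | succ j _ ih => rw [nextIter_succ, ih, Option.bind_none]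

theorem SatisfiesID.nextIter_eq {n : ℕ} {γ : Fin (n + 1) → S.OrientedArc} (h : SatisfiesID γ)
    (j : Fin (n + 1)) : nextIter j (S.opp (γ j)) = some (S.opp (γ 0)) := by
  induction j using Fin.induction with
  | zero => rfl
  | succ j ih =>
    rw [Fin.val_succ, nextIter_succ_of_some (isClockwiseChain_iff.1 h.1 j)]
    exact ih

/-- Predecessors are unique, so any sequence of successors arriving at `S.opp (γ 0)` retraces the
chain backwards; it cannot go beyond `γ (Fin.last n)`, whose reverse has no predecessor. -/
theorem SatisfiesID.le_of_nextIter_eq {n : ℕ} {γ : Fin (n + 1) → S.OrientedArc}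
    (h : SatisfiesID γ) {i : ℕ} {s : S.OrientedArc} (hs : nextIter i s = some (S.opp (γ 0))) :
    i ≤ n := by
  by_contra! hi
  have h1 : ∀ j : Fin (n + 1), nextIter (i - j) s = some (S.opp (γ j)) := by
    intro j
    induction j using Fin.induction with
    | zero => exact hs
    | succ j ih =>
      have h2 : i - (j.castSucc : ℕ) = i - (j.succ : ℕ) + 1 := by
        rw [Fin.val_castSucc, Fin.val_succ]
        omega
      rw [h2, nextIter_succ, Option.bind_eq_some_iff] at ih
      obtain ⟨r, hr, hr'⟩ := ih
      rw [hr, PolygonGluing.next_injective hr' (isClockwiseChain_iff.1 h.1 j)]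
  have h3 := h1 (Fin.last n)
  have h4 : i - (Fin.last n : ℕ) = i - n - 1 + 1 := by
    rw [Fin.val_last]
    omega
  rw [h4, nextIter_succ, Option.bind_eq_some_iff] at h3
  obtain ⟨r, -, hr⟩ := h3
  exact h.next_ne r hr

/-! ### Minimal projective resolutions of simple modules -/

variable (k) in
/-- The idempotent at the source of an oriented arc, or zero. -/
def optIdem : Option S.OrientedArc → S.GentleAlgebra k
  | some s => S.idem k (S.arc s)
  | none => 0

variable (k) in
/-- The arrow given by an oriented arc, or zero. -/
def optArrow : Option S.OrientedArc → S.GentleAlgebra k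
  | some s => arrowElem k s
  | none => 0

theorem optIdem_mul_self (o : Option S.OrientedArc) : optIdem k o * optIdem k o = optIdem k o := by
  rcases o with _ | s
  · exact mul_zero _
  · exact idem_mul_idem _

theorem optIdem_mul_optArrow (o : Option S.OrientedArc) :
    optIdem k o * optArrow k o = optArrow k o := by
  rcases o with _ | s
  · exact mul_zero _
  · exact idem_mul_arrowElem s

theorem optArrow_mul_optIdem (o : Option S.OrientedArc) :
    optArrow k o * optIdem k (o.bind S.next) = optArrow k o := by
  rcases o with _ | s
  · exact mul_zero _
  · rcases hs : S.next s with _ | t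
    · rw [Option.bind_some, hs]
      exact (mul_zero _).trans (arrowElem_of_none hs).symm
    · rw [Option.bind_some, hs]
      exact arrowElem_mul_idem hs

theorem optArrow_mul_optArrow (o : Option S.OrientedArc) :
    optArrow k o * optArrow k (o.bind S.next) = 0 := by
  rcases o with _ | s
  · exact mul_zero _
  · rw [Option.bind_some]
    rcases hs : S.next s with _ | t
    · exact mul_zero _
    · exact arrowElem_mul_arrowElem hs

theorem op_optArrow_mul_mem (o : Option S.OrientedArc) (y : S.GentleAlgebra k) :
    MulOpposite.op (optArrow k o * y) ∈ lengthIdeal S k 1 := by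
  rcases o with _ | s
  · have h : optArrow k none * y = 0 := zero_mul y
    rw [h, MulOpposite.op_zero]
    exact zero_mem _
  · exact op_arrowElem_mul_mem s y

theorem optArrow_mul_optIdem_mul (o : Option S.OrientedArc) (y : S.GentleAlgebra k) :
    optArrow k o * (optIdem k (o.bind S.next) * y) = optArrow k o * y := by
  rw [← mul_assoc, optArrow_mul_optIdem]

/-- Exactness in a form that also holds beyond the end of a chain: there the idempotent is zero and
forces `x = 0`. -/
theorem exists_optArrow_mul_eq (o : Option S.OrientedArc) {x : S.GentleAlgebra k}
    (hx : optIdem k (o.bind S.next) * x = x) (h : optArrow k o * x = 0) :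
    ∃ y, optIdem k ((o.bind S.next).bind S.next) * y = y ∧ optArrow k (o.bind S.next) * y = x := by
  suffices ∃ y, optArrow k (o.bind S.next) * y = x by
    -- Multiplying the witness by the idempotent puts it into the next projective without changing
    -- its image.
    obtain ⟨y, hy⟩ := this
    exact ⟨optIdem k ((o.bind S.next).bind S.next) * y, by rw [← mul_assoc, optIdem_mul_self],
      by rw [optArrow_mul_optIdem_mul, hy]⟩
  rcases o with _ | s
  · exact ⟨0, by rw [mul_zero, ← hx]; exact (zero_mul x).symm⟩
  · rw [Option.bind_some] at hx ⊢
    rcases hs : S.next s with _ | t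
    · rw [hs] at hx
      exact ⟨0, by rw [mul_zero, ← hx]; exact (zero_mul x).symm⟩
    · rw [hs] at hx
      obtain ⟨y, hy⟩ := exists_eq_arrowElem_mul hs hx h
      exact ⟨y, hy.symm⟩

variable (k) in
/-- The differentials of the resolution of a simple module, given by the arrows along the two
chains of sides. -/
def resolutionMap (o o' : ℕ → Option S.OrientedArc) : ℕ →
    (S.GentleAlgebra k × S.GentleAlgebra k →ₗ[(S.GentleAlgebra k)ᵐᵒᵖ]
      S.GentleAlgebra k × S.GentleAlgebra k)
  -- Both chains begin at the same arc, so in degree zero both summands map to the single projective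
  -- in the first factor.
  | 0 => LinearMap.inl _ _ _ ∘ₗ
      (leftMul (optArrow k (o 0))).coprod (leftMul (optArrow k (o' 0)))
  | j + 1 => (leftMul (optArrow k (o (j + 1)))).prodMap (leftMul (optArrow k (o' (j + 1))))

variable (k) in
/-- The idempotent of the second summand of a term of the resolution. -/
def sndIdem (o' : ℕ → Option S.OrientedArc) : ℕ → S.GentleAlgebra k
  | 0 => 0
  | j + 1 => optIdem k (o' (j + 1))

theorem sndIdem_mul_self (o' : ℕ → Option S.OrientedArc) (j : ℕ) :
    sndIdem k o' j * sndIdem k o' j = sndIdem k o' j := by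
  rcases j with _ | j
  · exact mul_zero _
  · exact optIdem_mul_self _

/-- Left multiplication by the two idempotents retracts the free module `A × A` onto `N`. -/
theorem projective_of_mem_iff {N : Submodule (S.GentleAlgebra k)ᵐᵒᵖ
      (S.GentleAlgebra k × S.GentleAlgebra k)} {f f' : S.GentleAlgebra k}
    (hf : f * f = f) (hf' : f' * f' = f') (hN : ∀ z, z ∈ N ↔ f * z.1 = z.1 ∧ f' * z.2 = z.2) :
    Module.Projective (S.GentleAlgebra k)ᵐᵒᵖ N := by
  refine Module.Projective.of_split N.subtype
    (((leftMul f).prodMap (leftMul f')).codRestrict N fun z => (hN _).2 ⟨?_, ?_⟩) ?_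
  · change f * (f * z.1) = f * z.1
    rw [← mul_assoc, hf]
  · change f' * (f' * z.2) = f' * z.2
    rw [← mul_assoc, hf']
  · ext z
    · exact ((hN _).1 z.2).1
    · exact ((hN _).1 z.2).2

/-- The generators `(f, 0)` and `(0, f')` lie in `N` itself, so radical coordinates place `z` in the
radical of `N` and not merely in that of the ambient module. -/
theorem mem_lengthIdeal_smul_top {N : Submodule (S.GentleAlgebra k)ᵐᵒᵖ
      (S.GentleAlgebra k × S.GentleAlgebra k)} {f f' : S.GentleAlgebra k}
    (hf : f * f = f) (hf' : f' * f' = f') (hN : ∀ z, z ∈ N ↔ f * z.1 = z.1 ∧ f' * z.2 = z.2)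
    (z : N) (h : MulOpposite.op z.1.1 ∈ lengthIdeal S k 1)
    (h' : MulOpposite.op z.1.2 ∈ lengthIdeal S k 1) :
    z ∈ lengthIdeal S k 1 • (⊤ : Submodule (S.GentleAlgebra k)ᵐᵒᵖ N) := by
  have h1 : z = MulOpposite.op z.1.1 • (⟨(f, 0), (hN _).2 ⟨hf, mul_zero _⟩⟩ : N) +
      MulOpposite.op z.1.2 • (⟨(0, f'), (hN _).2 ⟨mul_zero _, hf'⟩⟩ : N) := by
    refine Subtype.ext (Prod.ext ?_ ?_)
    · change z.1.1 = f * z.1.1 + 0 * z.1.2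
      rw [zero_mul, add_zero, ((hN _).1 z.2).1]
    · change z.1.2 = 0 * z.1.1 + f' * z.1.2
      rw [zero_mul, zero_add, ((hN _).1 z.2).2]
  rw [h1]
  exact add_mem (Submodule.smul_mem_smul h trivial) (Submodule.smul_mem_smul h' trivial)

end MarkedRibbonSurface

/-! ### Exactness and minimality of the resolution. -/

namespace MarkedRibbonSurface

variable {S : MarkedRibbonSurface} {k : Type u} [Field k]

section Resolution

variable {s : S.OrientedArc}
  {N : ℕ → Submodule (S.GentleAlgebra k)ᵐᵒᵖ (S.GentleAlgebra k × S.GentleAlgebra k)}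
  (hN : ∀ j z, z ∈ N j ↔ optIdem k (nextIter j s) * z.1 = z.1 ∧
    sndIdem k (fun i => nextIter i (S.opp s)) j * z.2 = z.2)

theorem resolutionMap_zero_apply (o o' : ℕ → Option S.OrientedArc)
    (z : S.GentleAlgebra k × S.GentleAlgebra k) :
    resolutionMap k o o' 0 z = (optArrow k (o 0) * z.1 + optArrow k (o' 0) * z.2, 0) := rfl

theorem resolutionMap_succ_apply (o o' : ℕ → Option S.OrientedArc) (j : ℕ)
    (z : S.GentleAlgebra k × S.GentleAlgebra k) :
    resolutionMap k o o' (j + 1) z =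
      (optArrow k (o (j + 1)) * z.1, optArrow k (o' (j + 1)) * z.2) := rfl

include hN in
theorem resolutionMap_mem (j : ℕ) (z : S.GentleAlgebra k × S.GentleAlgebra k) :
    resolutionMap k (fun i => nextIter i s) (fun i => nextIter i (S.opp s)) j z ∈ N j := by
  rw [hN]
  rcases j with _ | j
  · refine ⟨?_, mul_zero _⟩
    change S.idem k (S.arc s) * (arrowElem k s * z.1 + arrowElem k (S.opp s) * z.2) =
      arrowElem k s * z.1 + arrowElem k (S.opp s) * z.2
    rw [mul_add, ← mul_assoc, ← mul_assoc, idem_mul_arrowElem, ← arc_opp s, idem_mul_arrowElem]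
  · rw [resolutionMap_succ_apply]
    refine ⟨?_, ?_⟩
    · rw [← mul_assoc, optIdem_mul_optArrow]
    · change optIdem k (nextIter (j + 1) (S.opp s)) * _ = _
      rw [← mul_assoc, optIdem_mul_optArrow]

/-- In degree zero the two images are added, and the kernel still splits because the right ideals of
the two arrows meet in zero. -/
theorem resolutionMap_eq_zero_iff (j : ℕ) (z : S.GentleAlgebra k × S.GentleAlgebra k) :
    resolutionMap k (fun i => nextIter i s) (fun i => nextIter i (S.opp s)) j z = 0 ↔
      optArrow k (nextIter j s) * z.1 = 0 ∧ optArrow k (nextIter j (S.opp s)) * z.2 = 0 := by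
  rcases j with _ | j
  · rw [resolutionMap_zero_apply, Prod.mk_eq_zero]
    constructor
    · rintro ⟨h, -⟩
      have h1 : optArrow k (nextIter 0 s) * z.1 = 0 :=
        arrowElem_mul_eq_zero_of_add (S.opp_ne s).symm h
      rw [h1, zero_add] at h
      exact ⟨h1, h⟩
    · rintro ⟨h, h'⟩
      exact ⟨by rw [h, h', add_zero], rfl⟩
  · rw [resolutionMap_succ_apply, Prod.mk_eq_zero]

include hN in
theorem exists_resolutionMap_eq_iff (j : ℕ) {z : S.GentleAlgebra k × S.GentleAlgebra k}
    (hz : z ∈ N (j + 1)) :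
    resolutionMap k (fun i => nextIter i s) (fun i => nextIter i (S.opp s)) j z = 0 ↔
      ∃ w ∈ N (j + 2),
        resolutionMap k (fun i => nextIter i s) (fun i => nextIter i (S.opp s)) (j + 1) w = z := by
  rw [resolutionMap_eq_zero_iff]
  constructor
  · rintro ⟨h, h'⟩
    obtain ⟨h₁, h₂⟩ := (hN _ _).1 hz
    rw [nextIter_succ] at h₁
    change optIdem k (nextIter (j + 1) (S.opp s)) * _ = _ at h₂
    rw [nextIter_succ] at h₂
    obtain ⟨x, hx, hx'⟩ := exists_optArrow_mul_eq _ h₁ h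
    obtain ⟨y, hy, hy'⟩ := exists_optArrow_mul_eq _ h₂ h'
    rw [← nextIter_succ, ← nextIter_succ] at hx hy
    rw [← nextIter_succ] at hx' hy'
    exact ⟨(x, y), (hN _ _).2 ⟨hx, hy⟩, Prod.ext hx' hy'⟩
  · rintro ⟨w, -, rfl⟩
    rw [resolutionMap_succ_apply, ← mul_assoc, ← mul_assoc, nextIter_succ, nextIter_succ,
      optArrow_mul_optArrow, optArrow_mul_optArrow, zero_mul, zero_mul]
    exact ⟨rfl, rfl⟩

include hN in
theorem character_fst_eq_zero_iff {z : S.GentleAlgebra k × S.GentleAlgebra k} (hz : z ∈ N 0) :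
    S.character k (S.arc s) z.1 = 0 ↔
      ∃ w ∈ N 1, resolutionMap k (fun i => nextIter i s) (fun i => nextIter i (S.opp s)) 0 w = z
    := by
  obtain ⟨h₁, h₂⟩ := (hN _ _).1 hz
  constructor
  · intro h
    obtain ⟨x, y, hxy⟩ := exists_eq_of_character_eq_zero h₁ h
    refine ⟨(optIdem k (nextIter 1 s) * x, optIdem k (nextIter 1 (S.opp s)) * y),
      (hN _ _).2 ⟨?_, ?_⟩, Prod.ext ?_ ?_⟩
    · rw [← mul_assoc, optIdem_mul_self]
    · rw [← mul_assoc]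
      exact congrArg (· * y) (optIdem_mul_self _)
    · rw [resolutionMap_zero_apply, nextIter_succ, nextIter_succ, optArrow_mul_optIdem_mul,
        optArrow_mul_optIdem_mul]
      exact hxy.symm
    · exact (zero_mul _).symm.trans h₂
  · rintro ⟨w, -, rfl⟩
    change S.character k (S.arc s) (arrowElem k s * w.1 + arrowElem k (S.opp s) * w.2) = 0
    rw [map_add, map_mul, map_mul, character_arrowElem, character_arrowElem, zero_mul, zero_mul,
      add_zero]

variable (s) in
include hN in
theorem resolutionMap_mem_lengthIdeal_smul_top (j : ℕ) (z : N j)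
    {w : S.GentleAlgebra k × S.GentleAlgebra k}
    (h : resolutionMap k (fun i => nextIter i s) (fun i => nextIter i (S.opp s)) j w = z) :
    z ∈ lengthIdeal S k 1 • (⊤ : Submodule (S.GentleAlgebra k)ᵐᵒᵖ (N j)) := by
  refine mem_lengthIdeal_smul_top (optIdem_mul_self _) (sndIdem_mul_self _ _) (hN j) z ?_ ?_
  · rw [← h]
    rcases j with _ | j
    · rw [resolutionMap_zero_apply, MulOpposite.op_add]
      exact add_mem (op_optArrow_mul_mem _ _) (op_optArrow_mul_mem _ _)
    · exact op_optArrow_mul_mem _ _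
  · rw [← h]
    rcases j with _ | j
    · exact zero_mem _
    · exact op_optArrow_mul_mem _ _

-- Each kernel is the image of the next differential, so its elements have coordinates beginning
-- with arrows; it lies in the radical and is superfluous by nilpotence.
include hN in
theorem exists_isMinimalProjectiveResolution :
    ∃ (d : ∀ j, N (j + 1) →ₗ[(S.GentleAlgebra k)ᵐᵒᵖ] N j)
      (ε : N 0 →ₗ[(S.GentleAlgebra k)ᵐᵒᵖ] S.Simple k (S.arc s)),
      IsMinimalProjectiveResolution (fun j => N j) d ε := by
  let d : ∀ j, N (j + 1) →ₗ[(S.GentleAlgebra k)ᵐᵒᵖ] N j := fun j =>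
    (resolutionMap k (fun i => nextIter i s) (fun i => nextIter i (S.opp s)) j).restrict
      fun z _ => resolutionMap_mem hN j z
  let ε : N 0 →ₗ[(S.GentleAlgebra k)ᵐᵒᵖ] S.Simple k (S.arc s) :=
    (toSimple S k (S.arc s) ∘ₗ LinearMap.fst _ _ _).domRestrict (N 0)
  have h0 : Function.Exact (d 0) ε := by
    intro z
    refine (character_fst_eq_zero_iff hN z.2).trans ?_
    exact ⟨fun ⟨w, hw, h⟩ => ⟨⟨w, hw⟩, Subtype.ext h⟩,
      fun ⟨w, h⟩ => ⟨w, w.2, congrArg Subtype.val h⟩⟩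
  have h1 : ∀ j, Function.Exact (d (j + 1)) (d j) := by
    intro j z
    rw [← Subtype.val_inj]
    refine (exists_resolutionMap_eq_iff hN j z.2).trans ?_
    exact ⟨fun ⟨w, hw, h⟩ => ⟨⟨w, hw⟩, Subtype.ext h⟩,
      fun ⟨w, h⟩ => ⟨w, w.2, congrArg Subtype.val h⟩⟩
  refine ⟨d, ε, fun j => projective_of_mem_iff (optIdem_mul_self _) (sndIdem_mul_self _ _) (hN j),
    fun c => ?_, h0, h1, ?_, fun j => ?_⟩
  · obtain ⟨x, rfl⟩ := toSimple_proj_surjective (S.arc s) c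
    exact ⟨⟨(x, 0), (hN _ _).2 ⟨mem_proj_iff.1 x.2, mul_zero _⟩⟩, rfl⟩
  · refine isSuperfluous_of_le_lengthIdeal fun z hz => ?_
    obtain ⟨w, hw⟩ := (h0 z).1 hz
    exact resolutionMap_mem_lengthIdeal_smul_top s hN 0 z (congrArg Subtype.val hw)
  · refine isSuperfluous_of_le_lengthIdeal fun z hz => ?_
    obtain ⟨w, hw⟩ := (h1 j z).1 hz
    exact resolutionMap_mem_lengthIdeal_smul_top s hN (j + 1) z (congrArg Subtype.val hw)

end Resolution

theorem mem_bot_iff_zero_mul (x : S.GentleAlgebra k) :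
    x ∈ (⊥ : Submodule (S.GentleAlgebra k)ᵐᵒᵖ (S.GentleAlgebra k)) ↔
      (0 : S.GentleAlgebra k) * x = x := by
  rw [Submodule.mem_bot, zero_mul, eq_comm]

theorem mem_chainProj_iff {n : ℕ} {γ : Fin (n + 1) → S.OrientedArc} (h : SatisfiesPD γ) (j : ℕ)
    (x : S.GentleAlgebra k) :
    x ∈ chainProj k γ j ↔ optIdem k (nextIter j (γ 0)) * x = x := by
  unfold chainProj
  split_ifs with hj
  · rw [mem_proj_iff, h.nextIter_eq ⟨j, hj⟩]
    rfl
  · rw [h.nextIter_eq_none (by omega)]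
    exact mem_bot_iff_zero_mul x

theorem mem_resolutionTerm_iff {n m : ℕ} {γ : Fin (n + 1) → S.OrientedArc}
    {γ' : Fin (m + 1) → S.OrientedArc} (h : SatisfiesPD γ) (h' : SatisfiesPD γ') (j : ℕ)
    (z : S.GentleAlgebra k × S.GentleAlgebra k) :
    z ∈ resolutionTerm k γ γ' j ↔ optIdem k (nextIter j (γ 0)) * z.1 = z.1 ∧
      sndIdem k (fun i => nextIter i (γ' 0)) j * z.2 = z.2 := by
  rw [resolutionTerm, Submodule.mem_prod, mem_chainProj_iff h]
  refine and_congr_right fun _ => ?_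
  rcases j with _ | j
  · exact mem_bot_iff_zero_mul _
  · exact mem_chainProj_iff h' _ _

end MarkedRibbonSurface

end

open MarkedRibbonSurface in
theorem mainTheorem7 (k : Type u) [Field k] (S : MarkedRibbonSurface) (γ₀ : S.OrientedArc) :
    (∀ (n m : ℕ) (γ : Fin (n + 1) → S.OrientedArc) (γ' : Fin (m + 1) → S.OrientedArc),
      γ 0 = γ₀ → γ' 0 = S.opp γ₀ →
      MarkedRibbonSurface.SatisfiesPD γ → MarkedRibbonSurface.SatisfiesPD γ' →
      CategoryTheory.projectiveDimension
          (ModuleCat.of (S.GentleAlgebra k)ᵐᵒᵖ (S.Simple k (S.arc γ₀))) = ((max n m : ℕ) : ℕ∞) ∧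
      ∃ (d : ∀ j, MarkedRibbonSurface.resolutionTerm k γ γ' (j + 1) →ₗ[(S.GentleAlgebra k)ᵐᵒᵖ]
              MarkedRibbonSurface.resolutionTerm k γ γ' j)
          (ε : MarkedRibbonSurface.resolutionTerm k γ γ' 0 →ₗ[(S.GentleAlgebra k)ᵐᵒᵖ]
              S.Simple k (S.arc γ₀)),
        IsMinimalProjectiveResolution
          (fun j => MarkedRibbonSurface.resolutionTerm k γ γ' j) d ε) ∧
    (∀ (n m : ℕ) (γ : Fin (n + 1) → S.OrientedArc) (γ' : Fin (m + 1) → S.OrientedArc),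
      γ 0 = γ₀ → γ' 0 = S.opp γ₀ →
      MarkedRibbonSurface.SatisfiesID γ → MarkedRibbonSurface.SatisfiesID γ' →
      CategoryTheory.injectiveDimension
          (ModuleCat.of (S.GentleAlgebra k)ᵐᵒᵖ (S.Simple k (S.arc γ₀))) =
        ((max n m : ℕ) : ℕ∞)) := by
  constructor
  · rintro n m γ γ' rfl hγ' h h'
    refine ⟨?_, exists_isMinimalProjectiveResolution fun j z => ?_⟩
    · refine projectiveDimension_simple (h.nextIter_eq_none (by omega)) ?_ ?_
      · rw [← hγ']
        exact h'.nextIter_eq_none (by omega)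
      · rw [← hγ']
        rcases max_choice n m with hm | hm
        · rw [hm]
          exact Or.inl ((h.nextIter_eq (Fin.last n)).symm ▸ Option.some_ne_none _)
        · rw [hm]
          exact Or.inr ((h'.nextIter_eq (Fin.last m)).symm ▸ Option.some_ne_none _)
    · rw [← hγ']
      exact mem_resolutionTerm_iff h h' j z
  · rintro n m γ γ' rfl hγ' h h'
    -- The arc has two orientations: chains arriving at `S.opp (γ 0)` have length at most `n`, and
    -- those arriving at `γ 0 = S.opp (γ' 0)` length at most `m`.
    have h1 : ∀ s r, nextIter (max n m + 1) s = some r → S.arc r ≠ S.arc (γ 0) := by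
      intro s r hr hr'
      rcases eq_or_eq_opp_of_arc_eq hr' with rfl | rfl
      · have h2 := h'.le_of_nextIter_eq (i := max n m + 1) (s := s) (by rw [hγ', S.opp_opp, hr])
        omega
      · have h2 := h.le_of_nextIter_eq hr
        omega
    -- The bound is attained by the longer chain, read backwards from the reverse of its last arc.
    rcases max_choice n m with hm | hm
    · refine injectiveDimension_simple h1 (s := S.opp (γ (Fin.last n))) (r := S.opp (γ 0)) ?_
        (arc_opp _)
      rw [hm]
      exact h.nextIter_eq (Fin.last n)
    · refine injectiveDimension_simple h1 (s := S.opp (γ' (Fin.last m))) (r := γ 0) ?_ rfl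
      rw [hm, ← S.opp_opp (γ 0), ← hγ']
      exact h'.nextIter_eq (Fin.last m)
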